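/- Let $(M,g)$ be a smooth manifold of arbitrary dimension $n$ with a smooth Lorentzian metric of signature $(-,+,\dots,+)$. Definitions. $g$ is \emph{$0$-universal} if every symmetric tensor field $T_{ab}$ that is a contraction of a polynomial (with constant coefficients) in the metric and the Riemann tensor (no covariant derivatives of the latter) and that is conserved on $(M,g)$, i.e. $\nabla^b T_{ab}=0$, is a multiple of $g_{ab}$. A \emph{recurrent null vector} is a smooth nowhere vanishing null vector field $\ell$ on $M$ with $\nabla_b\ell_a=L\,\ell_a\ell_b$ for some function $L$; it is \emph{covariantly constant} if $\nabla_b\ell_a=0$, and a \emph{pp-wave} is a Lorentzian manifold that admits a covariantly constant null vector. A null frame $\ell,n,m_{(2)},\dots,m_{(n-1)}$ at a point satisfies $\ell\cdot\ell=n\cdot n=\ell\cdot m_{(i)}=n\cdot m_{(i)}=0$, $\ell\cdot n=1$, $m_{(i)}\cdot m_{(j)}=\delta_{ij}$; the boost weight of a frame component of a covariant tensor is the number of its indices contracted with $\ell$ minus the number contracted with $n$. The Weyl tensor at a point is of \emph{genuine type II} (type D included; types III, N, O excluded) if there is a null frame in which all its components of positive boost weight vanish, but no null frame in which all its components of non-negative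 boost weight vanish. Proposition. Suppose that $g$ is $0$-universal. (i) If $g$ is Ricci-flat and admits a recurrent null vector, then there is no point of $M$ at which the Weyl tensor is of genuine type II. That is, in any dimension there are no recurrent Ricci-flat genuine type II $0$-universal spacetimes. (ii) If $g$ admits a covariantly constant null vector, then there is no point of $M$ at which the Weyl tensor is of genuine type II. (Ricci-flatness is not assumed.) That is, type II $0$-universal pp-waves do not exist. -/

import Mathlib

open scoped Manifold ContDiff Matrix

/-! ### Tensor calculus in a coordinate domain

Points of a coordinate domain are `y : EuclideanSpace ℝ (Fin n)`.  A covariant tensor of rank `r`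
is given by its components, indexed by `Fin r → Fin n`. -/

namespace Coord

/-- Components of a field of covariant tensors of rank `r` in a coordinate domain. -/
abbrev TField (n r : ℕ) : Type :=
  EuclideanSpace ℝ (Fin n) → (Fin r → Fin n) → ℝ

/-- Components `g_{ij}` of a metric in a coordinate domain. -/
abbrev Metric (n : ℕ) : Type :=
  EuclideanSpace ℝ (Fin n) → Matrix (Fin n) (Fin n) ℝ

variable {n : ℕ}

/-- The partial derivative `∂_k f` at `y`. -/
noncomputable def pd (k : Fin n) (f : EuclideanSpace ℝ (Fin n) → ℝ)
    (y : EuclideanSpace ℝ (Fin n)) : ℝ :=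
  fderiv ℝ f y (EuclideanSpace.single k 1)

/-- The Christoffel symbol `Γ^c_{ab}` of the Levi-Civita connection; `(G y)⁻¹` has the entries
`g^{cd}`. -/
noncomputable def christoffel (G : Metric n) (y : EuclideanSpace ℝ (Fin n)) (c a b : Fin n) : ℝ :=
  (1 / 2) * ∑ d, (G y)⁻¹ c d *
    (pd a (fun z => G z d b) y + pd b (fun z => G z d a) y - pd d (fun z => G z a b) y)

/-- The curvature `R^a_{bcd} = ∂_c Γ^a_{db} - ∂_d Γ^a_{cb} + Γ^a_{ce} Γ^e_{db} - Γ^a_{de} Γ^e_{cb}`. -/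
noncomputable def riemannUp (G : Metric n) (y : EuclideanSpace ℝ (Fin n)) (a b c d : Fin n) : ℝ :=
  pd c (fun z => christoffel G z a d b) y - pd d (fun z => christoffel G z a c b) y
    + ∑ e, (christoffel G y a c e * christoffel G y e d b
      - christoffel G y a d e * christoffel G y e c b)

/-- The Riemann tensor `R_{abcd}`. -/
noncomputable def riemann (G : Metric n) (y : EuclideanSpace ℝ (Fin n)) (a b c d : Fin n) : ℝ :=
  ∑ e, G y a e * riemannUp G y e b c d

/-- The Ricci tensor `R_{bd} = R^a_{bad}`. -/
noncomputable def ricci (G : Metric n) (y : EuclideanSpace ℝ (Fin n)) (b d : Fin n) : ℝ :=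
  ∑ a, riemannUp G y a b a d

/-- The Ricci scalar. -/
noncomputable def scalarCurv (G : Metric n) (y : EuclideanSpace ℝ (Fin n)) : ℝ :=
  ∑ b, ∑ d, (G y)⁻¹ b d * ricci G y b d

/-- The Weyl tensor `C_{abcd}`. -/
noncomputable def weyl (G : Metric n) (y : EuclideanSpace ℝ (Fin n)) (a b c d : Fin n) : ℝ :=
  riemann G y a b c d
    - (1 / ((n : ℝ) - 2)) *
      (G y a c * ricci G y b d - G y a d * ricci G y b c
        + G y b d * ricci G y a c - G y b c * ricci G y a d)
    + (scalarCurv G y / (((n : ℝ) - 1) * ((n : ℝ) - 2))) *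
      (G y a c * G y b d - G y a d * G y b c)

/-- The covariant derivative: `T_{a₁…a_r;b} = ∂_b T_{a₁…a_r} - ∑_i Γ^c_{b a_i} T_{a₁…c…a_r}`.
The index of differentiation is the last one. -/
noncomputable def nabla (G : Metric n) {r : ℕ} (T : TField n r) : TField n (r + 1) :=
  fun y idx =>
    pd (idx (Fin.last r)) (fun z => T z (fun i => idx i.castSucc)) y
      - ∑ i : Fin r, ∑ c, christoffel G y c (idx (Fin.last r)) (idx i.castSucc) *
          T y (Function.update (fun j => idx j.castSucc) i c)

/-- The `j`-th covariant derivative of the Riemann tensor. -/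
noncomputable def nablaRiemann (G : Metric n) : (j : ℕ) → TField n (4 + j)
  | 0 => fun y idx => riemann G y (idx 0) (idx 1) (idx 2) (idx 3)
  | j + 1 => nabla G (nablaRiemann G j)

/-- The divergence `g^{bc} T_{ab;c}` of a tensor of rank 2. -/
noncomputable def divergence (G : Metric n) (T : TField n 2) (y : EuclideanSpace ℝ (Fin n))
    (a : Fin n) : ℝ :=
  ∑ b, ∑ c, (G y)⁻¹ b c * nabla G T y ![a, b, c]

end Coord

/-- Formal expressions for the covariant tensors of rank `r` that are obtained by contraction of
polynomials in the metric, the Riemann tensor and its covariant derivatives up to order `k`. -/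
inductive CurvExpr (k : ℕ) : ℕ → Type
  | metric : CurvExpr k 2
  | riem (j : ℕ) (hj : j ≤ k) : CurvExpr k (4 + j)
  | add {r : ℕ} (S T : CurvExpr k r) : CurvExpr k r
  | smul {r : ℕ} (c : ℝ) (T : CurvExpr k r) : CurvExpr k r
  | tensor {r s : ℕ} (S : CurvExpr k r) (T : CurvExpr k s) : CurvExpr k (r + s)
  | perm {r : ℕ} (σ : Equiv.Perm (Fin r)) (T : CurvExpr k r) : CurvExpr k r
  | contract {r : ℕ} (T : CurvExpr k (r + 2)) : CurvExpr k r

/-- The components of the tensor field that an expression denotes for the metric `G`.  The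
constructor `contract` contracts the last two indices with the inverse metric. -/
noncomputable def CurvExpr.eval {n k : ℕ} (G : Coord.Metric n) :
    {r : ℕ} → CurvExpr k r → Coord.TField n r
  | _, .metric => fun y idx => G y (idx 0) (idx 1)
  | _, .riem j _ => Coord.nablaRiemann G j
  | _, .add S T => fun y idx => S.eval G y idx + T.eval G y idx
  | _, .smul c T => fun y idx => c * T.eval G y idx
  | _, .tensor (r := r) (s := s) S T => fun y idx =>
      S.eval G y (fun i => idx (Fin.castAdd s i)) * T.eval G y (fun i => idx (Fin.natAdd r i))
  | _, .perm σ T => fun y idx => T.eval G y (fun i => idx (σ i))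
  | _, .contract T => fun y idx =>
      ∑ c, ∑ d, (G y)⁻¹ c d * T.eval G y (Fin.append idx ![c, d])

/-! ### Null frames and boost order -/

/-- Labels of the vectors `ℓ`, `n`, `m_i` of a null frame in dimension `n`. -/
inductive FrameLabel (n : ℕ) : Type
  | l : FrameLabel n
  | k : FrameLabel n
  | m (i : Fin (n - 2)) : FrameLabel n

/-- The boost weight of a frame label: under `ℓ ↦ λ ℓ`, `n ↦ λ⁻¹ n`, `m_i ↦ m_i` the frame vector
is multiplied by `λ` to this power. -/
def FrameLabel.boostWeight {n : ℕ} : FrameLabel n → ℤ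
  | .l => 1
  | .k => -1
  | .m _ => 0

/-- The Gram matrix of a null frame: `ℓ·n = 1`, `m_i·m_j = δ_{ij}`, all other products zero. -/
def FrameLabel.gram {n : ℕ} : FrameLabel n → FrameLabel n → ℝ
  | .l, .k => 1
  | .k, .l => 1
  | .m i, .m j => if i = j then 1 else 0
  | _, _ => 0

/-- `e` is a null frame for the scalar product with matrix `A`. -/
def IsNullFrame {n : ℕ} (A : Matrix (Fin n) (Fin n) ℝ) (e : FrameLabel n → Fin n → ℝ) : Prop :=
  ∀ α β, e α ⬝ᵥ (A *ᵥ e β) = α.gram β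

/-- With respect to the frame `e`, the boost order of the tensor `C_{abcd}` is at most `w`: all
frame components of a boost weight greater than `w` vanish. -/
def BoostOrderLE {n : ℕ} (C : Fin n → Fin n → Fin n → Fin n → ℝ) (e : FrameLabel n → Fin n → ℝ)
    (w : ℤ) : Prop :=
  ∀ α β γ δ : FrameLabel n,
    w < α.boostWeight + β.boostWeight + γ.boostWeight + δ.boostWeight →
      ∑ a, ∑ b, ∑ c, ∑ d, C a b c d * e α a * e β b * e γ c * e δ d = 0

/-- The tensor `C_{abcd}` is of genuine type II (type D included, types III, N and O excluded):
its boost order is at most `0` in some null frame and at most `-1` in none. -/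
def IsGenuineTypeII {n : ℕ} (A : Matrix (Fin n) (Fin n) ℝ)
    (C : Fin n → Fin n → Fin n → Fin n → ℝ) : Prop :=
  (∃ e, IsNullFrame A e ∧ BoostOrderLE C e 0) ∧ ¬ ∃ e, IsNullFrame A e ∧ BoostOrderLE C e (-1)

/-! ### Lorentzian manifolds -/

/-- The coordinate vector `∂_i` of a chart `e`, at the point with coordinates `y`. -/
noncomputable def coordVec {n : ℕ} {M : Type*} [TopologicalSpace M]
    [ChartedSpace (EuclideanSpace ℝ (Fin n)) M]
    (e : OpenPartialHomeomorph M (EuclideanSpace ℝ (Fin n))) (y : EuclideanSpace ℝ (Fin n))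
    (i : Fin n) : TangentSpace (𝓡 n) (e.symm y) :=
  mfderiv (𝓡 n) (𝓡 n) e.symm y (EuclideanSpace.single i (1 : ℝ))

/-- A smooth metric of signature `(-,+,…,+)`.  Smoothness means that the components are smooth in
every chart of the atlas. -/
structure LorentzMetric (n : ℕ) (M : Type*) [TopologicalSpace M]
    [ChartedSpace (EuclideanSpace ℝ (Fin n)) M] where
  val : ∀ p : M, LinearMap.BilinForm ℝ (TangentSpace (𝓡 n) p)
  symm : ∀ (p : M) (u v : TangentSpace (𝓡 n) p), val p u v = val p v u
  lorentzian : ∀ p : M, ∃ (b : Module.Basis (Fin n) ℝ (TangentSpace (𝓡 n) p)) (i₀ : Fin n),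
    ∀ i j, val p (b i) (b j) = if i = j then (if i = i₀ then -1 else 1) else 0
  smooth : ∀ e ∈ atlas (EuclideanSpace ℝ (Fin n)) M, ∀ i j : Fin n,
    ContDiffOn ℝ ∞ (fun y => val (e.symm y) (coordVec e y i) (coordVec e y j)) e.target

namespace LorentzMetric

variable {n : ℕ} {M : Type*} [TopologicalSpace M] [ChartedSpace (EuclideanSpace ℝ (Fin n)) M]

/-- The components `g_{ij}` of the metric in a chart. -/
noncomputable def comp (g : LorentzMetric n M)
    (e : OpenPartialHomeomorph M (EuclideanSpace ℝ (Fin n))) : Coord.Metric n :=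
  fun y => Matrix.of fun i j => g.val (e.symm y) (coordVec e y i) (coordVec e y j)

/-- The components `ℓ_i = g(ℓ, ∂_i)` of a vector field in a chart, with the index lowered. -/
noncomputable def lower (g : LorentzMetric n M) (l : ∀ p : M, TangentSpace (𝓡 n) p)
    (e : OpenPartialHomeomorph M (EuclideanSpace ℝ (Fin n))) : Coord.TField n 1 :=
  fun y idx => g.val (e.symm y) (l (e.symm y)) (coordVec e y (idx 0))

/-- The Ricci tensor vanishes. -/
def IsRicciFlat (g : LorentzMetric n M) : Prop :=
  ∀ e ∈ atlas (EuclideanSpace ℝ (Fin n)) M, ∀ y ∈ e.target, ∀ a b : Fin n,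
    Coord.ricci (g.comp e) y a b = 0

/-- The expression `T` defines a symmetric tensor field on the manifold. -/
def IsSymmetric (g : LorentzMetric n M) {k : ℕ} (T : CurvExpr k 2) : Prop :=
  ∀ e ∈ atlas (EuclideanSpace ℝ (Fin n)) M, ∀ y ∈ e.target, ∀ a b : Fin n,
    T.eval (g.comp e) y ![a, b] = T.eval (g.comp e) y ![b, a]

/-- The expression `T` defines a conserved (divergence-free) tensor field on the manifold. -/
def IsConserved (g : LorentzMetric n M) {k : ℕ} (T : CurvExpr k 2) : Prop :=
  ∀ e ∈ atlas (EuclideanSpace ℝ (Fin n)) M, ∀ y ∈ e.target, ∀ a : Fin n,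
    Coord.divergence (g.comp e) (T.eval (g.comp e)) y a = 0

/-- The expression `T` defines a multiple of the metric. (For a conserved `T` the factor is then
locally constant.) -/
def IsMultipleOfMetric (g : LorentzMetric n M) {k : ℕ} (T : CurvExpr k 2) : Prop :=
  ∀ e ∈ atlas (EuclideanSpace ℝ (Fin n)) M, ∀ y ∈ e.target, ∃ c : ℝ, ∀ a b : Fin n,
    T.eval (g.comp e) y ![a, b] = c * g.comp e y a b

/-- The metric is `k`-universal: all conserved symmetric tensors of rank 2 constructed from the
metric, the Riemann tensor and its covariant derivatives up to order `k` are multiples of the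
metric. -/
def IsUniversal (g : LorentzMetric n M) (k : ℕ) : Prop :=
  ∀ T : CurvExpr k 2, g.IsSymmetric T → g.IsConserved T → g.IsMultipleOfMetric T

/-- `l` is a smooth, nowhere vanishing null vector field. -/
def IsNullVectorField (g : LorentzMetric n M) (l : ∀ p : M, TangentSpace (𝓡 n) p) : Prop :=
  (∀ p, l p ≠ 0) ∧ (∀ p, g.val p (l p) (l p) = 0) ∧
    ∀ e ∈ atlas (EuclideanSpace ℝ (Fin n)) M, ∀ i : Fin n,
      ContDiffOn ℝ ∞ (fun y => g.lower l e y ![i]) e.target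

/-- There is a recurrent null vector field: `ℓ_{a;b} = L ℓ_a ℓ_b` for some function `L`. -/
def AdmitsRecurrentNullVector (g : LorentzMetric n M) : Prop :=
  ∃ l : ∀ p : M, TangentSpace (𝓡 n) p, g.IsNullVectorField l ∧ ∃ L : M → ℝ,
    ∀ e ∈ atlas (EuclideanSpace ℝ (Fin n)) M, ∀ y ∈ e.target, ∀ a b : Fin n,
      Coord.nabla (g.comp e) (g.lower l e) y ![a, b] =
        L (e.symm y) * g.lower l e y ![a] * g.lower l e y ![b]

/-- There is a covariantly constant null vector field, `ℓ_{a;b} = 0` (a pp-wave). -/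
def AdmitsCovariantlyConstantNullVector (g : LorentzMetric n M) : Prop :=
  ∃ l : ∀ p : M, TangentSpace (𝓡 n) p, g.IsNullVectorField l ∧
    ∀ e ∈ atlas (EuclideanSpace ℝ (Fin n)) M, ∀ y ∈ e.target, ∀ a b : Fin n,
      Coord.nabla (g.comp e) (g.lower l e) y ![a, b] = 0

/-- At the point `p` the Weyl tensor is of genuine type II. -/
def IsGenuineTypeIIAt (g : LorentzMetric n M) (p : M) : Prop :=
  let e := chartAt (EuclideanSpace ℝ (Fin n)) p
  IsGenuineTypeII (g.comp e (e p)) (Coord.weyl (g.comp e) (e p))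

end LorentzMetric

/-!
Both parts rest on conserved tensors that exist on every Lorentzian manifold. The twice contracted
Bianchi identity makes the Einstein tensor conserved (`FormalMetric.div2_einstein`), and for a
Ricci-flat metric the Bianchi identities make the Gauss–Bonnet tensor
`R_{acde} R_b{}^{cde} - (1/4) R_{cdef} R^{cdef} g_{ab}` conserved (`FormalMetric.div2_gaussBonnet`).
On a `0`-universal spacetime both have to be multiples of the metric.

If the null vector `ℓ` is covariantly constant, then `ℓ^a R_{abcd} = 0`, hence `ℓ^a R_{ab} = 0`. As
the Einstein tensor is a multiple of the metric, so is the Ricci tensor, which therefore vanishes.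
Thus the second part follows from the first.

If `ℓ_{a;b} = L ℓ_a ℓ_b`, the Ricci identity reads `ℓ^a R_{abcd} = ℓ_b (v_d ℓ_c - v_c ℓ_d)` with
`v = dL` (`FormalMetric.sum_mul_Rm_of_recurrent`), and Ricci-flatness forces `v · ℓ = 0`. The tensor
`R_{acde} R_b{}^{cde}` is a multiple of the metric, and its contraction with `ℓ` is zero
(`FormalMetric.dot_quad`), so that it vanishes, and so does its trace `R_{abcd} R^{abcd}`. In a null
frame `ℓ, n, m_i` that starts with `ℓ`, every component of non-negative boost weight with an index
`ℓ` vanishes. The square of the Riemann tensor is therefore the sum of the squares of its components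
`R_{ijkl}` along the `m_i`, and these vanish too. The Weyl tensor, which equals the Riemann tensor,
has boost order at most `-1` (`IsNullFrame.boostOrderLE_neg_one`) and is not of genuine type II.

The tensor calculus is carried out over a commutative algebra with commuting derivations, a
`FormalMetric`, where differentiability is no issue. It is applied to the ring of smooth functions
on the domain of a chart, and evaluation at a point gives the coordinate expressions.
-/

/-! ### Metrics over a differential ring -/

/-- A metric over a commutative `ℝ`-algebra `A` of "functions" that carries commuting derivations
`D i` (the "partial derivatives"), together with its inverse `h`. -/
structure FormalMetric (ι A : Type*) [Fintype ι] [DecidableEq ι] [CommRing A] [Algebra ℝ A] where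
  D : ι → Derivation ℝ A A
  D_comm : ∀ i j a, D i (D j a) = D j (D i a)
  g : Matrix ι ι A
  h : Matrix ι ι A
  g_symm : ∀ i j, g i j = g j i
  g_mul_h : g * h = 1

namespace FormalMetric

variable {ι A : Type*} [Fintype ι] [DecidableEq ι] [CommRing A] [Algebra ℝ A]
  (F : FormalMetric ι A)

/-- The entrywise derivative of a matrix. -/
def dM (k : ι) (M : Matrix ι ι A) : Matrix ι ι A := M.map (F.D k)

lemma dM_mul (k : ι) (M N : Matrix ι ι A) : F.dM k (M * N) = F.dM k M * N + M * F.dM k N := by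
  ext i j
  simp only [dM, Matrix.map_apply, Matrix.mul_apply, map_sum, Derivation.leibniz, smul_eq_mul,
    Matrix.add_apply, ← Finset.sum_add_distrib]
  exact Finset.sum_congr rfl fun _ _ => by ring

lemma dM_add (k : ι) (M N : Matrix ι ι A) : F.dM k (M + N) = F.dM k M + F.dM k N := by
  ext i j; simp [dM]

lemma dM_sub (k : ι) (M N : Matrix ι ι A) : F.dM k (M - N) = F.dM k M - F.dM k N := by
  ext i j; simp [dM]

lemma dM_one (k : ι) : F.dM k (1 : Matrix ι ι A) = 0 := by
  ext i j
  by_cases hij : i = j <;> simp [dM, hij]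

lemma dM_transpose (k : ι) (M : Matrix ι ι A) : F.dM k Mᵀ = (F.dM k M)ᵀ := rfl

lemma dM_comm (i j : ι) (M : Matrix ι ι A) : F.dM i (F.dM j M) = F.dM j (F.dM i M) := by
  ext a b; exact F.D_comm i j _

lemma h_mul_g : F.h * F.g = 1 := mul_eq_one_comm.mp F.g_mul_h

lemma g_transpose : F.gᵀ = F.g := by ext i j; exact F.g_symm j i

lemma h_transpose : F.hᵀ = F.h := by
  have h1 : F.hᵀ * F.g = 1 := by
    rw [← F.g_transpose, ← Matrix.transpose_mul, F.g_mul_h, Matrix.transpose_one]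
  calc F.hᵀ = F.hᵀ * (F.g * F.h) := by rw [F.g_mul_h, mul_one]
    _ = F.h := by rw [← mul_assoc, h1, one_mul]

lemma h_symm (i j : ι) : F.h i j = F.h j i := congrFun (congrFun F.h_transpose j) i

/-! ### The Levi-Civita connection and its curvature -/

/-- The Christoffel symbols of the first kind `Γ_{d,kb}`, as a matrix in `d` and `b`. -/
noncomputable def lowChristoffel (k : ι) : Matrix ι ι A := fun d b =>
  (1 / 2 : ℝ) • (F.D k (F.g d b) + F.D b (F.g d k) - F.D d (F.g k b))

/-- The Christoffel symbols `Γ^c_{kb}`, as a matrix in `c` and `b`. -/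
noncomputable def Γ (k : ι) : Matrix ι ι A := F.h * F.lowChristoffel k

lemma g_mul_Γ (k : ι) : F.g * F.Γ k = F.lowChristoffel k := by
  rw [Γ, ← mul_assoc, F.g_mul_h, one_mul]

lemma Γ_symm (k c b : ι) : F.Γ k c b = F.Γ b c k := by
  simp only [Γ, Matrix.mul_apply, lowChristoffel]
  refine Finset.sum_congr rfl fun d _ => ?_
  rw [F.g_symm k b, add_comm (F.D k (F.g d b))]

/-- The metric is covariantly constant, in terms of the connection matrices. -/
lemma dM_g (k : ι) : F.dM k F.g = (F.Γ k)ᵀ * F.g + F.g * F.Γ k := by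
  have h1 : (F.Γ k)ᵀ * F.g = (F.lowChristoffel k)ᵀ := by
    rw [← F.g_mul_Γ, Matrix.transpose_mul, F.g_transpose]
  rw [h1, F.g_mul_Γ]
  ext a b
  simp only [dM, Matrix.map_apply, Matrix.add_apply, Matrix.transpose_apply, lowChristoffel,
    F.g_symm b a, F.g_symm k a, F.g_symm k b, ← smul_add]
  rw [show F.D k (F.g a b) + F.D a (F.g b k) - F.D b (F.g a k)
      + (F.D k (F.g a b) + F.D b (F.g a k) - F.D a (F.g b k)) = (2 : ℝ) • F.D k (F.g a b) by
    rw [two_smul]; ring, smul_smul]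
  norm_num

lemma dM_h (k : ι) : F.dM k F.h = -(F.Γ k * F.h + F.h * (F.Γ k)ᵀ) := by
  have h0 : F.dM k F.g * F.h + F.g * F.dM k F.h = 0 := by
    rw [← F.dM_mul, F.g_mul_h, F.dM_one]
  have h1 : F.g * F.dM k F.h = -(F.dM k F.g * F.h) := by
    rw [eq_neg_iff_add_eq_zero, add_comm, h0]
  calc F.dM k F.h = F.h * (F.g * F.dM k F.h) := by rw [← mul_assoc, F.h_mul_g, one_mul]
    _ = -(F.h * (F.Γ k)ᵀ * (F.g * F.h) + F.h * F.g * F.Γ k * F.h) := by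
      rw [h1, F.dM_g]; noncomm_ring
    _ = _ := by rw [F.g_mul_h, F.h_mul_g, mul_one, one_mul, add_comm]

/-- The curvature `R^a_{bcd}`, as a matrix in `a` and `b`: the curvature form
`∂_c Γ_d - ∂_d Γ_c + [Γ_c, Γ_d]` of the connection matrices. -/
noncomputable def Rm (c d : ι) : Matrix ι ι A :=
  F.dM c (F.Γ d) - F.dM d (F.Γ c) + (F.Γ c * F.Γ d - F.Γ d * F.Γ c)

lemma Rm_antisymm (c d : ι) : F.Rm c d = -F.Rm d c := by
  simp only [Rm]; noncomm_ring

/-- The first Bianchi identity. -/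
lemma Rm_cyclic (a b c d : ι) : F.Rm c d a b + F.Rm d b a c + F.Rm b c a d = 0 := by
  simp only [Rm, Matrix.add_apply, Matrix.sub_apply, Matrix.mul_apply, dM, Matrix.map_apply,
    ← Finset.sum_sub_distrib]
  rw [F.Γ_symm d a b, F.Γ_symm c a b, F.Γ_symm d a c]
  have h1 : ∀ x, F.Γ d x b = F.Γ b x d := fun x => F.Γ_symm d x b
  have h2 : ∀ x, F.Γ c x b = F.Γ b x c := fun x => F.Γ_symm c x b
  have h3 : ∀ x, F.Γ d x c = F.Γ c x d := fun x => F.Γ_symm d x c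
  simp only [h1, h2, h3, Finset.sum_sub_distrib]
  ring

/-- The second Bianchi identity, for the curvature as an endomorphism. -/
lemma Rm_bianchi (c d e : ι) :
    (F.dM e (F.Rm c d) + (F.Γ e * F.Rm c d - F.Rm c d * F.Γ e))
      + (F.dM c (F.Rm d e) + (F.Γ c * F.Rm d e - F.Rm d e * F.Γ c))
      + (F.dM d (F.Rm e c) + (F.Γ d * F.Rm e c - F.Rm e c * F.Γ d)) = 0 := by
  simp only [Rm, dM_add, dM_sub, dM_mul]
  rw [F.dM_comm e c (F.Γ d), F.dM_comm e d (F.Γ c), F.dM_comm c d (F.Γ e)]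
  noncomm_ring

/-- The curvature is skew for the metric, since the metric is covariantly constant. -/
lemma g_mul_Rm (c d : ι) : F.g * F.Rm c d + (F.Rm c d)ᵀ * F.g = 0 := by
  have key : F.dM c (F.dM d F.g) - F.dM d (F.dM c F.g) = 0 := by
    rw [F.dM_comm c d, sub_self]
  rw [F.dM_g d, F.dM_g c] at key
  simp only [dM_add, dM_mul, dM_transpose] at key
  rw [F.dM_g d, F.dM_g c] at key
  rw [← key]
  simp only [Rm, Matrix.transpose_add, Matrix.transpose_sub, Matrix.transpose_mul]
  noncomm_ring

/-- The Riemann tensor `R_{abcd}`. -/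
noncomputable def Riem (a b c d : ι) : A := (F.g * F.Rm c d) a b

lemma Riem_swap_right (a b c d : ι) : F.Riem a b c d = -F.Riem a b d c := by
  rw [Riem, Riem, F.Rm_antisymm c d, mul_neg]; rfl

lemma Riem_swap_left (a b c d : ι) : F.Riem a b c d = -F.Riem b a c d := by
  have h1 := congrFun (congrFun (F.g_mul_Rm c d) a) b
  have h2 : ((F.Rm c d)ᵀ * F.g) = (F.g * F.Rm c d)ᵀ := by
    rw [Matrix.transpose_mul, F.g_transpose]
  rw [h2] at h1
  exact eq_neg_of_add_eq_zero_left h1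

lemma Riem_cyclic (a b c d : ι) : F.Riem a b c d + F.Riem a c d b + F.Riem a d b c = 0 := by
  simp only [Riem, Matrix.mul_apply, ← Finset.sum_add_distrib, ← mul_add, F.Rm_cyclic, mul_zero,
    Finset.sum_const_zero]

lemma eq_of_two_mul_eq {x y : A} (hxy : 2 * x = 2 * y) : x = y := by
  have h1 : (1 / 2 : ℝ) • (2 * x) = (1 / 2 : ℝ) • (2 * y) := by rw [hxy]
  rw [two_mul, two_mul, ← two_smul ℝ x, ← two_smul ℝ y, smul_smul, smul_smul] at h1
  norm_num at h1
  exact h1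

lemma Riem_pair (a b c d : ι) : F.Riem a b c d = F.Riem c d a b := by
  apply eq_of_two_mul_eq
  have h1 := F.Riem_cyclic a b c d
  have h2 := F.Riem_cyclic b c d a
  have h3 := F.Riem_cyclic c d a b
  have h4 := F.Riem_cyclic d a b c
  linear_combination h1 - h2 - h3 + h4 + F.Riem_swap_left b a c d - F.Riem_swap_left d c a b
    + F.Riem_swap_left c a b d - F.Riem_swap_right a c b d + F.Riem_swap_left c b d a
    - F.Riem_swap_left d a b c - F.Riem_swap_left d b c a + F.Riem_swap_right b d c a

/-! ### Contractions and covariant derivatives -/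

/-- The contraction `g^{cd} u_{cd}`. -/
def ctr (u : ι → ι → A) : A := ∑ c, ∑ d, F.h c d * u c d

/-- The contribution `Γ^p_{ka} t_p` of one index to a covariant derivative. -/
noncomputable def act (k a : ι) (t : ι → A) : A := ∑ p, F.Γ k p a * t p

/-- The covariant derivative `t_{ab;k}`. -/
noncomputable def cov2 (t : ι → ι → A) (k a b : ι) : A :=
  F.D k (t a b) - F.act k a (fun p => t p b) - F.act k b (fun p => t a p)

/-- The covariant derivative `t_{abcd;k}`. -/
noncomputable def cov4 (t : ι → ι → ι → ι → A) (k a b c d : ι) : A :=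
  F.D k (t a b c d) - F.act k a (fun p => t p b c d) - F.act k b (fun p => t a p c d)
    - F.act k c (fun p => t a b p d) - F.act k d (fun p => t a b c p)

lemma ctr_congr {u v : ι → ι → A} (huv : ∀ c d, u c d = v c d) : F.ctr u = F.ctr v := by
  simp only [ctr, huv]

lemma ctr_add (u v : ι → ι → A) : F.ctr (fun c d => u c d + v c d) = F.ctr u + F.ctr v := by
  simp [ctr, mul_add, Finset.sum_add_distrib]

lemma ctr_sub (u v : ι → ι → A) : F.ctr (fun c d => u c d - v c d) = F.ctr u - F.ctr v := by
  simp [ctr, mul_sub, Finset.sum_sub_distrib]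

lemma ctr_neg (u : ι → ι → A) : F.ctr (fun c d => -u c d) = -F.ctr u := by
  simp [ctr]

lemma ctr_mul_left (x : A) (u : ι → ι → A) : F.ctr (fun c d => x * u c d) = x * F.ctr u := by
  simp only [ctr, Finset.mul_sum]
  exact Finset.sum_congr rfl fun _ _ => Finset.sum_congr rfl fun _ _ => by ring

lemma ctr_mul_right (x : A) (u : ι → ι → A) : F.ctr (fun c d => u c d * x) = F.ctr u * x := by
  simp only [mul_comm _ x, ctr_mul_left]

lemma ctr_zero : F.ctr (fun _ _ => 0) = 0 := by simp [ctr]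

lemma ctr_swap (u : ι → ι → A) : F.ctr (fun c d => u d c) = F.ctr u := by
  simp only [ctr]
  rw [Finset.sum_comm]
  exact Finset.sum_congr rfl fun _ _ => Finset.sum_congr rfl fun _ _ => by rw [F.h_symm]

lemma ctr_comm (u : ι → ι → ι → ι → A) :
    F.ctr (fun a b => F.ctr (fun c d => u a b c d)) =
      F.ctr (fun c d => F.ctr (fun a b => u a b c d)) := by
  have h1 : ∀ v : ι → ι → A, F.ctr v = ∑ p : ι × ι, F.h p.1 p.2 * v p.1 p.2 := fun v => by
    rw [ctr, Fintype.sum_prod_type]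
  simp only [h1, Finset.mul_sum]
  rw [Finset.sum_comm]
  exact Finset.sum_congr rfl fun _ _ => Finset.sum_congr rfl fun _ _ => by ring

lemma ctr_g_right (t : ι → A) (b : ι) : F.ctr (fun c d => t c * F.g b d) = t b := by
  have h1 : ∀ c, ∑ d, F.h c d * F.g b d = (1 : Matrix ι ι A) c b := fun c => by
    rw [← F.h_mul_g, Matrix.mul_apply]
    exact Finset.sum_congr rfl fun d _ => by rw [F.g_symm]
  simp only [ctr]
  calc _ = ∑ c, t c * ∑ d, F.h c d * F.g b d :=
        Finset.sum_congr rfl fun c _ => by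
          rw [Finset.mul_sum]; exact Finset.sum_congr rfl fun _ _ => by ring
    _ = t b := by simp [h1, Matrix.one_apply]

lemma act_neg (k a : ι) (t : ι → A) : F.act k a (fun p => -t p) = -F.act k a t := by
  simp [act]

lemma act_mul_left (k a : ι) (x : A) (t : ι → A) :
    F.act k a (fun p => x * t p) = x * F.act k a t := by
  simp only [act, Finset.mul_sum]
  exact Finset.sum_congr rfl fun _ _ => by ring

lemma act_mul_right (k a : ι) (x : A) (t : ι → A) :
    F.act k a (fun p => t p * x) = F.act k a t * x := by
  simp only [mul_comm _ x, act_mul_left]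

lemma act_ctr (k a : ι) (u : ι → ι → ι → A) :
    F.act k a (fun p => F.ctr (fun c d => u p c d)) =
      F.ctr (fun c d => F.act k a (fun p => u p c d)) := by
  simp only [act, ctr, Finset.mul_sum]
  rw [Finset.sum_comm]
  refine Finset.sum_congr rfl fun _ _ => ?_
  rw [Finset.sum_comm]
  exact Finset.sum_congr rfl fun _ _ => Finset.sum_congr rfl fun _ _ => by ring

/-- Contraction commutes with covariant differentiation. -/
lemma D_ctr (k : ι) (u : ι → ι → A) : F.D k (F.ctr u) = F.ctr (fun c d => F.cov2 u k c d) := by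
  have h1 : ∀ v : ι → ι → A, F.ctr v = Matrix.trace (F.h * (Matrix.of v)) := fun v => by
    simp only [Matrix.trace, Matrix.diag, Matrix.mul_apply, Matrix.of_apply]
    rw [← F.ctr_swap]; simp only [ctr]
  have h2 : ∀ M : Matrix ι ι A, F.D k M.trace = (F.dM k M).trace := fun M => by
    simp [Matrix.trace, dM]
  have h3 : Matrix.of (fun c d => F.cov2 u k c d) =
      F.dM k (Matrix.of u) - (F.Γ k)ᵀ * Matrix.of u - Matrix.of u * F.Γ k := by
    ext c d
    simp only [Matrix.of_apply, cov2, Matrix.sub_apply, dM, Matrix.map_apply, Matrix.mul_apply,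
      act, Matrix.transpose_apply, mul_comm (u c _)]
  rw [h1, h1, h2, dM_mul, dM_h, h3, mul_sub, mul_sub, ← mul_assoc, ← mul_assoc, neg_mul, add_mul,
    Matrix.trace_add, Matrix.trace_sub, Matrix.trace_sub, Matrix.trace_neg, Matrix.trace_add,
    Matrix.trace_mul_comm (F.h * Matrix.of u) (F.Γ k), mul_assoc (F.Γ k) F.h]
  ring

lemma cov2_g (k a b : ι) : F.cov2 F.g k a b = 0 := by
  have h1 := congrFun (congrFun (F.dM_g k) a) b
  simp only [dM, Matrix.map_apply, Matrix.add_apply, Matrix.mul_apply, Matrix.transpose_apply] at h1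
  simp only [cov2, act, h1, mul_comm (F.g a _)]
  ring

/-! ### The Bianchi identities for the Riemann tensor -/

lemma cov4_Riem_swap_left (k a b c d : ι) :
    F.cov4 F.Riem k a b c d = -F.cov4 F.Riem k b a c d := by
  simp only [cov4]
  rw [show (fun p => F.Riem p b c d) = fun p => -F.Riem b p c d from
      funext fun p => F.Riem_swap_left _ _ _ _,
    show (fun p => F.Riem a p c d) = fun p => -F.Riem p a c d from
      funext fun p => F.Riem_swap_left _ _ _ _,
    show (fun p => F.Riem a b p d) = fun p => -F.Riem b a p d from
      funext fun p => F.Riem_swap_left _ _ _ _,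
    show (fun p => F.Riem a b c p) = fun p => -F.Riem b a c p from
      funext fun p => F.Riem_swap_left _ _ _ _, F.Riem_swap_left a b c d]
  simp only [act_neg, map_neg]
  ring

lemma cov4_Riem_pair (k a b c d : ι) : F.cov4 F.Riem k a b c d = F.cov4 F.Riem k c d a b := by
  simp only [cov4]
  rw [show (fun p => F.Riem p b c d) = fun p => F.Riem c d p b from
      funext fun p => F.Riem_pair _ _ _ _,
    show (fun p => F.Riem a p c d) = fun p => F.Riem c d a p from
      funext fun p => F.Riem_pair _ _ _ _,
    show (fun p => F.Riem a b p d) = fun p => F.Riem p d a b from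
      funext fun p => F.Riem_pair _ _ _ _,
    show (fun p => F.Riem a b c p) = fun p => F.Riem c p a b from
      funext fun p => F.Riem_pair _ _ _ _, F.Riem_pair a b c d]
  ring

lemma cov4_Riem_swap_right (k a b c d : ι) :
    F.cov4 F.Riem k a b c d = -F.cov4 F.Riem k a b d c := by
  rw [cov4_Riem_pair, cov4_Riem_swap_left, cov4_Riem_pair]

/-- The second Bianchi identity `R_{ab[cd;k]} = 0`. -/
lemma cov4_Riem_bianchi (k a b c d : ι) :
    F.cov4 F.Riem k a b c d + F.cov4 F.Riem c a b d k + F.cov4 F.Riem d a b k c = 0 := by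
  have h1 : ∀ k c d, F.dM k (F.g * F.Rm c d) - (F.Γ k)ᵀ * (F.g * F.Rm c d)
      - F.g * F.Rm c d * F.Γ k
      = F.g * (F.dM k (F.Rm c d) + (F.Γ k * F.Rm c d - F.Rm c d * F.Γ k)) := fun k c d => by
    rw [dM_mul, dM_g]; noncomm_ring
  have h2 : ∀ k c d, F.D k (F.Riem a b c d) - F.act k a (fun p => F.Riem p b c d)
      - F.act k b (fun p => F.Riem a p c d)
      = (F.g * (F.dM k (F.Rm c d) + (F.Γ k * F.Rm c d - F.Rm c d * F.Γ k))) a b := fun k c d => by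
    rw [← h1]
    simp only [Matrix.sub_apply, Matrix.mul_apply (M := (F.Γ k)ᵀ),
      Matrix.mul_apply (M := F.g * F.Rm c d), Matrix.transpose_apply, act, Riem, dM,
      Matrix.map_apply, mul_comm (F.Γ k _ b)]
  have h3 := congrArg (fun M => F.g * M) (F.Rm_bianchi c d k)
  beta_reduce at h3
  rw [mul_add, mul_add, mul_zero] at h3
  replace h3 := congrFun (congrFun h3 a) b
  simp only [Matrix.add_apply, Matrix.zero_apply] at h3
  have h5 : ∀ k c x, F.act k c (fun p => F.Riem a b p x) = -F.act c k (fun p => F.Riem a b x p) :=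
    fun k c x => by
      rw [← act_neg]
      refine Finset.sum_congr rfl fun p _ => ?_
      beta_reduce
      rw [F.Γ_symm, F.Riem_swap_right]
  simp only [cov4, h2]
  linear_combination h3 - h5 k c d - h5 c d k - h5 d k c

/-! ### Conservation of the Einstein tensor -/

/-- The Ricci tensor `R_{bd} = g^{ac} R_{abcd}`. -/
noncomputable def Ric (b d : ι) : A := F.ctr (fun a c => F.Riem a b c d)

/-- The Ricci scalar. -/
noncomputable def scal : A := F.ctr F.Ric

lemma Ric_symm (b d : ι) : F.Ric b d = F.Ric d b := by
  rw [Ric, ← F.ctr_swap]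
  simp only [F.Riem_pair _ b _ d]
  rfl

lemma cov2_Ric (k b d : ι) : F.cov2 F.Ric k b d = F.ctr (fun a c => F.cov4 F.Riem k a b c d) := by
  have h1 : F.D k (F.Ric b d) = F.ctr (fun a c => F.cov2 (fun a c => F.Riem a b c d) k a c) :=
    F.D_ctr k _
  simp only [cov2] at h1 ⊢
  rw [h1]
  simp only [Ric, act_ctr, ← ctr_sub, cov4]
  refine F.ctr_congr fun a c => ?_; ring

lemma cov2_Ric_symm (k b d : ι) : F.cov2 F.Ric k b d = F.cov2 F.Ric k d b := by
  simp only [cov2, F.Ric_symm d b]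
  rw [show (fun p => F.Ric d p) = fun p => F.Ric p d from funext fun p => F.Ric_symm _ _,
    show (fun p => F.Ric b p) = fun p => F.Ric p b from funext fun p => F.Ric_symm _ _]
  ring

/-- The divergence of a tensor of rank 2 on its second index. -/
noncomputable def div2 (t : ι → ι → A) (a : ι) : A := F.ctr (fun b c => F.cov2 t c a b)

/-- The contracted Bianchi identity `R_{bijk}{}^{;b} = R_{ik;j} - R_{ij;k}`. -/
lemma div_Riem (i j k : ι) : F.ctr (fun b f => F.cov4 F.Riem f b i j k) =
    F.cov2 F.Ric j i k - F.cov2 F.Ric k i j := by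
  rw [cov2_Ric, cov2_Ric, ← ctr_sub]
  refine F.ctr_congr fun b f => ?_
  linear_combination F.cov4_Riem_bianchi f b i j k - F.cov4_Riem_swap_right j b i k f

/-- The twice contracted Bianchi identity. -/
lemma two_mul_div2_Ric (j : ι) : 2 * F.div2 F.Ric j = F.D j F.scal := by
  have h1 : F.ctr (fun i k => F.ctr (fun b f => F.cov4 F.Riem f b i j k)) = F.div2 F.Ric j := by
    rw [ctr_comm, div2]
    refine F.ctr_congr fun b f => ?_
    rw [← F.ctr_swap, cov2_Ric]
    refine F.ctr_congr fun i k => ?_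
    rw [cov4_Riem_pair, cov4_Riem_swap_left, cov4_Riem_swap_right, neg_neg]
  have h2 : F.ctr (fun i k => F.ctr (fun b f => F.cov4 F.Riem f b i j k))
      = F.D j F.scal - F.div2 F.Ric j := by
    simp only [div_Riem, ctr_sub]
    rw [scal, D_ctr, div2, F.ctr_congr (fun i k => F.cov2_Ric_symm k i j)]
  linear_combination h2 - h1

lemma cov2_sub (s t : ι → ι → A) (k a b : ι) :
    F.cov2 (fun a b => s a b - t a b) k a b = F.cov2 s k a b - F.cov2 t k a b := by
  simp only [cov2, act, map_sub, mul_sub, Finset.sum_sub_distrib]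
  ring

lemma cov2_mul_g (x : A) (k a b : ι) :
    F.cov2 (fun a b => x * F.g a b) k a b = F.D k x * F.g a b := by
  have h1 := F.cov2_g k a b
  simp only [cov2] at h1 ⊢
  simp only [act_mul_left, Derivation.leibniz, smul_eq_mul]
  linear_combination x * h1

lemma div2_sub_mul_g (t : ι → ι → A) (x : A) (a : ι) :
    F.div2 (fun a b => t a b - x * F.g a b) a = F.div2 t a - F.D a x := by
  simp only [div2, cov2_sub, cov2_mul_g, ctr_sub]
  congr 1
  rw [← F.ctr_swap]
  exact F.ctr_g_right (fun c => F.D c x) a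

/-- The Einstein tensor is conserved. -/
lemma div2_einstein (a : ι) :
    F.div2 (fun a b => F.Ric a b - ((1 / 2 : ℝ) • F.scal) * F.g a b) a = 0 := by
  rw [div2_sub_mul_g, Derivation.map_smul, ← two_mul_div2_Ric, two_mul, ← two_smul ℝ, smul_smul]
  norm_num

/-! ### Conservation of the Gauss–Bonnet tensor of a Ricci-flat metric -/

/-- The tensor `R_{acde} R_b{}^{cde}`. -/
noncomputable def quad (a b : ι) : A :=
  F.ctr fun c i => F.ctr fun d j => F.ctr fun e k => F.Riem a c d e * F.Riem b i j k

lemma quad_symm (a b : ι) : F.quad a b = F.quad b a := by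
  simp only [quad]
  rw [← F.ctr_swap]; refine F.ctr_congr fun c i => ?_
  rw [← F.ctr_swap]; refine F.ctr_congr fun d j => ?_
  rw [← F.ctr_swap]; refine F.ctr_congr fun e k => ?_
  ring

lemma cov2_quad (f a b : ι) : F.cov2 F.quad f a b =
    F.ctr fun c i => F.ctr fun d j => F.ctr fun e k =>
      F.cov4 F.Riem f a c d e * F.Riem b i j k + F.Riem a c d e * F.cov4 F.Riem f b i j k := by
  simp only [cov2, quad, D_ctr, act_ctr, ← ctr_sub, act_mul_left, act_mul_right,
    Derivation.leibniz, smul_eq_mul, cov4]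
  refine F.ctr_congr fun c i => ?_
  refine F.ctr_congr fun d j => ?_
  refine F.ctr_congr fun e k => ?_
  ring

/-- The scalar product of tensors of rank 4. -/
noncomputable def inner4 (X Y : ι → ι → ι → ι → A) : A :=
  F.ctr fun f b => F.ctr fun c i => F.ctr fun d j => F.ctr fun e k => X f c d e * Y b i j k

lemma inner4_swap (X Y : ι → ι → ι → ι → A) :
    F.inner4 (fun f c => X c f) (fun f c => Y c f) = F.inner4 X Y := by
  simp only [inner4]
  rw [ctr_comm]

lemma inner4_comm (X Y : ι → ι → ι → ι → A) : F.inner4 X Y = F.inner4 Y X := by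
  simp only [inner4]
  rw [← F.ctr_swap]; refine F.ctr_congr fun f b => ?_
  rw [← F.ctr_swap]; refine F.ctr_congr fun c i => ?_
  rw [← F.ctr_swap]; refine F.ctr_congr fun d j => ?_
  rw [← F.ctr_swap]; refine F.ctr_congr fun e k => ?_
  ring

/-- The square `R_{abcd} R^{abcd}`. -/
noncomputable def kretschmann : A := F.ctr F.quad

lemma D_kretschmann (a : ι) :
    F.D a F.kretschmann = 2 * F.inner4 (F.cov4 F.Riem a) F.Riem := by
  rw [kretschmann, D_ctr]
  simp only [cov2_quad, ctr_add]
  have h1 := F.inner4_comm F.Riem (F.cov4 F.Riem a)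
  have h2 : F.inner4 (F.cov4 F.Riem a) F.Riem + F.inner4 F.Riem (F.cov4 F.Riem a)
      = 2 * F.inner4 (F.cov4 F.Riem a) F.Riem := by rw [h1, two_mul]
  rw [← h2]
  simp only [inner4]

/-- `R_{acde;f} R^{fcde} = (1/2) R_{fcde;a} R^{fcde}`, by the second Bianchi identity. -/
lemma two_mul_inner4_cov4_Riem (a : ι) :
    2 * F.inner4 (fun f c d e => F.cov4 F.Riem f a c d e) F.Riem
      = F.inner4 (F.cov4 F.Riem a) F.Riem := by
  have h1 : F.inner4 (fun f c d e => F.cov4 F.Riem c a f d e) F.Riem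
      = -F.inner4 (fun f c d e => F.cov4 F.Riem f a c d e) F.Riem := by
    rw [← inner4_swap]
    simp only [inner4, ← ctr_neg]
    refine F.ctr_congr fun f b => ?_
    refine F.ctr_congr fun c i => ?_
    refine F.ctr_congr fun d j => ?_
    refine F.ctr_congr fun e k => ?_
    rw [F.Riem_swap_left i b]; ring
  have h2 : F.inner4 (F.cov4 F.Riem a) F.Riem
      = F.inner4 (fun f c d e => F.cov4 F.Riem f a c d e) F.Riem
        - F.inner4 (fun f c d e => F.cov4 F.Riem c a f d e) F.Riem := by
    simp only [inner4, ← ctr_sub]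
    refine F.ctr_congr fun f b => ?_
    refine F.ctr_congr fun c i => ?_
    refine F.ctr_congr fun d j => ?_
    refine F.ctr_congr fun e k => ?_
    rw [← sub_mul]
    congr 1
    have h3 := F.cov4_Riem_bianchi a d e f c
    rw [F.cov4_Riem_pair a, F.cov4_Riem_pair f, F.cov4_Riem_pair c,
      F.cov4_Riem_swap_left f c a] at h3
    linear_combination h3
  linear_combination h1 - h2

/-- For a Ricci-flat metric the tensor `R_{acde} R_b{}^{cde} - (1/4) R_{cdef} R^{cdef} g_{ab}` is
conserved. -/
lemma div2_gaussBonnet (hRic : ∀ a b, F.Ric a b = 0) (a : ι) :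
    F.div2 (fun a b => F.quad a b - ((1 / 4 : ℝ) • F.kretschmann) * F.g a b) a = 0 := by
  have h0 : F.Ric = fun _ _ => 0 := funext fun a => funext fun b => hRic a b
  have h1 : ∀ k a b, F.cov2 F.Ric k a b = 0 := fun k a b => by simp [h0, cov2, act]
  have h2 : F.ctr (fun b f => F.ctr fun c i => F.ctr fun d j => F.ctr fun e k =>
      F.Riem a c d e * F.cov4 F.Riem f b i j k) = 0 := by
    rw [ctr_comm]
    rw [← F.ctr_zero]; refine F.ctr_congr fun c i => ?_
    rw [ctr_comm]
    rw [← F.ctr_zero]; refine F.ctr_congr fun d j => ?_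
    rw [ctr_comm]
    rw [← F.ctr_zero]; refine F.ctr_congr fun e k => ?_
    rw [ctr_mul_left, div_Riem, h1, h1, sub_zero, mul_zero]
  have h3 : F.div2 F.quad a = F.inner4 (fun f c d e => F.cov4 F.Riem f a c d e) F.Riem := by
    simp only [div2, cov2_quad, ctr_add, h2, add_zero]
    rw [← F.ctr_swap]; rfl
  have h4 : F.D a F.kretschmann
      = (4 : ℝ) • F.inner4 (fun f c d e => F.cov4 F.Riem f a c d e) F.Riem := by
    rw [D_kretschmann, ← two_mul_inner4_cov4_Riem, Algebra.smul_def, map_ofNat]; ring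
  rw [div2_sub_mul_g, Derivation.map_smul, h4, h3, smul_smul]
  norm_num

/-! ### Recurrent covectors -/

/-- The covariant derivative `l_{a;b}`. -/
noncomputable def cov1 (l : ι → A) (b a : ι) : A := F.D b (l a) - F.act b a l

/-- The Ricci identity for a recurrent covector `l_{a;b} = L l_a l_b`. -/
lemma sum_mul_Rm_of_recurrent (l : ι → A) (L : A) (hl : ∀ a b, F.cov1 l b a = L * l a * l b)
    (c d b : ι) : ∑ a, l a * F.Rm c d a b = l b * (F.D d L * l c - F.D c L * l d) := by
  have h1 : ∀ a b, F.D b (l a) = F.act b a l + L * l a * l b := fun a b => by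
    rw [← hl, cov1]; ring
  have h2 : ∀ c d b, F.D c (F.D d (l b)) =
      (∑ p, F.D c (F.Γ d p b) * l p + ∑ p, l p * (F.Γ c * F.Γ d) p b + L * l c * F.act d b l)
      + (F.D c L * l b * l d + L * (F.act c b l + L * l b * l c) * l d
        + L * l b * (F.act c d l + L * l d * l c)) := fun c d b => by
    have h3 : F.D c (F.act d b l) =
        ∑ p, F.D c (F.Γ d p b) * l p + ∑ p, l p * (F.Γ c * F.Γ d) p b
          + L * l c * F.act d b l := by
      have h4 : ∑ p, l p * (F.Γ c * F.Γ d) p b = F.act d b (fun q => F.act c q l) := by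
        simp only [Matrix.mul_apply, act, Finset.mul_sum]
        rw [Finset.sum_comm]
        exact Finset.sum_congr rfl fun _ _ => Finset.sum_congr rfl fun _ _ => by ring
      rw [h4, ← act_mul_left]
      simp only [act, map_sum, Derivation.leibniz, smul_eq_mul, ← Finset.sum_add_distrib]
      refine Finset.sum_congr rfl fun p _ => ?_
      rw [h1, act]; ring
    rw [h1, map_add, h3]
    simp only [Derivation.leibniz, smul_eq_mul, h1]
    ring
  have h5 := F.D_comm c d (l b)
  rw [h2, h2] at h5
  have h6 : F.act c d l = F.act d c l := Finset.sum_congr rfl fun p _ => by rw [F.Γ_symm]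
  simp only [Rm, Matrix.add_apply, Matrix.sub_apply, dM, Matrix.map_apply, mul_add, mul_sub,
    Finset.sum_add_distrib, Finset.sum_sub_distrib]
  simp only [mul_comm (F.D _ _) (l _)] at h5
  rw [h6] at h5
  linear_combination h5

/-- The scalar product of covectors. -/
def dot (s t : ι → A) : A := F.ctr fun c d => s c * t d

lemma dot_comm (s t : ι → A) : F.dot s t = F.dot t s := by
  rw [dot, ← ctr_swap]
  exact F.ctr_congr fun _ _ => mul_comm _ _

lemma dot_Riem (l : ι → A) (b c d : ι) :
    F.dot l (fun a => F.Riem a b c d) = ∑ a, l a * F.Rm c d a b := by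
  have h1 : ∀ p, (F.h * (F.g * F.Rm c d)) p b = F.Rm c d p b := fun p => by
    rw [← mul_assoc, F.h_mul_g, one_mul]
  simp only [dot, ctr, Riem, ← h1]
  refine Finset.sum_congr rfl fun p _ => ?_
  rw [Matrix.mul_apply, Finset.mul_sum]
  exact Finset.sum_congr rfl fun a _ => by ring

/-- A covector that is annihilated by the Riemann tensor is annihilated by the Ricci tensor. -/
lemma dot_Ric {l : ι → A} (hR : ∀ b c d, F.dot l (fun a => F.Riem a b c d) = 0) (b : ι) :
    F.dot l (fun a => F.Ric a b) = 0 := by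
  simp only [dot] at hR
  simp only [dot, Ric, ← ctr_mul_left]
  rw [ctr_comm, ← F.ctr_zero]
  refine F.ctr_congr fun a c => ?_
  rw [← hR a b c]
  refine F.ctr_congr fun p d => ?_
  rw [F.Riem_swap_left, F.Riem_swap_right, neg_neg]

variable {l v : ι → A}

/-- Contracting the Ricci identity of a recurrent null covector shows that the gradient of the
recurrence function is orthogonal to it if the Ricci tensor vanishes. -/
lemma mul_dot_eq_zero
    (hR : ∀ b c d, F.dot l (fun a => F.Riem a b c d) = l b * (v d * l c - v c * l d))
    (hnull : F.dot l l = 0) (hRic : ∀ a b, F.Ric a b = 0) (b : ι) :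
    l b * F.dot v l = 0 := by
  calc l b * F.dot v l = F.ctr fun a c => l c * (v a * l b - v b * l a) := by
        have h1 := F.ctr_mul_right (l b) (fun a c => v a * l c)
        have h2 := F.ctr_mul_left (v b) (fun a c => l a * l c)
        have h3 : F.ctr (fun a c => l c * (v a * l b - v b * l a))
            = F.ctr (fun a c => v a * l c * l b) - F.ctr (fun a c => v b * (l a * l c)) := by
          rw [← ctr_sub]; exact F.ctr_congr fun _ _ => by ring
        rw [h3, h1, h2]
        change l b * F.dot v l = F.dot v l * l b - v b * F.dot l l
        rw [hnull]; ring
    _ = F.ctr fun a c => F.ctr fun p d => l p * F.Riem d c b a :=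
        F.ctr_congr fun a c => (hR c b a).symm
    _ = F.ctr fun p d => l p * F.Ric b d := by
        rw [ctr_comm]
        refine F.ctr_congr fun p d => ?_
        rw [ctr_mul_left, Ric]
        congr 1
        refine F.ctr_congr fun a c => ?_
        rw [Riem_pair, Riem_swap_left, Riem_swap_right, neg_neg]
    _ = 0 := by simp only [hRic, mul_zero, ctr_zero]

/-- The contraction of `R_{acde} R_b{}^{cde}` with the null covector vanishes. -/
lemma dot_quad
    (hR : ∀ b c d, F.dot l (fun a => F.Riem a b c d) = l b * (v d * l c - v c * l d))
    (hnull : F.dot l l = 0) (hv : F.dot v l = 0) (b : ι) :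
    F.dot l (fun a => F.quad a b) = 0 := by
  have h1 : ∀ x y z w : ι → A, F.ctr (fun d j => F.ctr fun e k => (x d * z e) * (y j * w k))
      = F.dot x y * F.dot z w := fun x y z w => by
    rw [dot, ← ctr_mul_right]
    refine F.ctr_congr fun d j => ?_
    rw [dot, ← ctr_mul_left]
    exact F.ctr_congr fun _ _ => by ring
  have h4 : ∀ w : ι → ι → ι → ι → ι → ι → ι → ι → A,
      F.ctr (fun p a => F.ctr fun c i => F.ctr fun d j => F.ctr fun e k => w p a c i d j e k)
      = F.ctr (fun d j => F.ctr fun e k => F.ctr fun c i => F.ctr fun p a => w p a c i d j e k) :=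
    fun w => by
      rw [ctr_comm]
      simp only [F.ctr_comm (fun p a d j => F.ctr fun e k => w p a _ _ d j e k)]
      rw [ctr_comm]
      refine F.ctr_congr fun d j => ?_
      simp only [F.ctr_comm (fun p a e k => w p a _ _ d j e k)]
      rw [ctr_comm]
  calc F.dot l (fun a => F.quad a b)
      = F.ctr fun d j => F.ctr fun e k => F.ctr fun c i =>
          F.dot l (fun a => F.Riem a c d e) * F.Riem b i j k := by
        simp only [dot, quad, ← ctr_mul_left, ← ctr_mul_right]
        rw [h4]
        exact F.ctr_congr fun _ _ => F.ctr_congr fun _ _ => F.ctr_congr fun _ _ =>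
          F.ctr_congr fun _ _ => by ring
    _ = F.ctr fun d j => F.ctr fun e k =>
          -(l b * ((v e * l d - v d * l e) * (v k * l j - v j * l k))) := by
        refine F.ctr_congr fun d j => F.ctr_congr fun e k => ?_
        have h2 : F.dot l (fun i => F.Riem b i j k) = -(l b * (v k * l j - v j * l k)) := by
          rw [← hR, dot, dot, ← ctr_neg]
          exact F.ctr_congr fun c i => by rw [F.Riem_swap_left b i]; ring
        rw [dot] at h2
        rw [show -(l b * ((v e * l d - v d * l e) * (v k * l j - v j * l k)))
          = (v e * l d - v d * l e) * -(l b * (v k * l j - v j * l k)) by ring, ← h2,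
          ← ctr_mul_left]
        exact F.ctr_congr fun c i => by rw [hR]; ring
    _ = -(l b * ((F.dot l l * F.dot v v - F.dot l v * F.dot v l)
          - (F.dot v l * F.dot l v - F.dot v v * F.dot l l))) := by
        simp only [← h1, ← ctr_sub, ← ctr_mul_left, ← ctr_neg]
        exact F.ctr_congr fun d j => F.ctr_congr fun e k => by ring
    _ = 0 := by rw [F.dot_comm l v, hnull, hv]; ring

end FormalMetric

/-! ### The differential ring of smooth functions on a coordinate domain -/

section SmoothRing

variable {n : ℕ} (U : Set (EuclideanSpace ℝ (Fin n)))

/-- The algebra of smooth functions on a subset `U` of a coordinate space. Its elements are functions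
on the subtype `U`, so that equality only concerns values in `U`. -/
def smoothRing : Subalgebra ℝ (U → ℝ) where
  carrier := {f | ∃ φ : EuclideanSpace ℝ (Fin n) → ℝ, ContDiffOn ℝ ∞ φ U ∧ ∀ u : U, f u = φ u}
  mul_mem' := by
    rintro f f' ⟨φ, hφ, h⟩ ⟨φ', hφ', h'⟩
    exact ⟨fun y => φ y * φ' y, hφ.mul hφ', fun u => by simp [h, h']⟩
  add_mem' := by
    rintro f f' ⟨φ, hφ, h⟩ ⟨φ', hφ', h'⟩
    exact ⟨fun y => φ y + φ' y, hφ.add hφ', fun u => by simp [h, h']⟩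
  algebraMap_mem' := fun c => ⟨fun _ => c, contDiffOn_const, fun _ => rfl⟩

variable {U}

namespace smoothRing

/-- Evaluation at a point of `U`. -/
def ev (u : U) : smoothRing U →+* ℝ := (Pi.evalRingHom (fun _ : U => ℝ) u).comp (smoothRing U).val

@[simp] lemma ev_smul (u : U) (c : ℝ) (f : smoothRing U) : ev u (c • f) = c * ev u f := rfl

lemma ext_ev {f f' : smoothRing U} (hf : ∀ u, ev u f = ev u f') : f = f' :=
  Subtype.ext (funext hf)

/-- The extension of a smooth function on `U` by zero. -/
noncomputable def zeroExt (f : smoothRing U) : EuclideanSpace ℝ (Fin n) → ℝ :=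
  Function.extend Subtype.val f.1 0

lemma zeroExt_apply (f : smoothRing U) (u : U) : (zeroExt f) u = ev u f :=
  Subtype.val_injective.extend_apply _ _ _

lemma contDiffOn_zeroExt (f : smoothRing U) : ContDiffOn ℝ ∞ (zeroExt f) U := by
  obtain ⟨φ, hφ, h⟩ := f.2
  exact hφ.congr fun y hy => (zeroExt_apply f ⟨y, hy⟩).trans (h ⟨y, hy⟩)

/-- The element of the ring that a smooth function on `U` defines. -/
def ofFun (φ : EuclideanSpace ℝ (Fin n) → ℝ) (hφ : ContDiffOn ℝ ∞ φ U) : smoothRing U :=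
  ⟨fun u => φ u, φ, hφ, fun _ => rfl⟩

@[simp] lemma ev_ofFun (φ : EuclideanSpace ℝ (Fin n) → ℝ) (hφ : ContDiffOn ℝ ∞ φ U) (u : U) :
    ev u (ofFun φ hφ) = φ u := rfl

lemma contDiffOn_pd (hU : IsOpen U) (k : Fin n) {φ : EuclideanSpace ℝ (Fin n) → ℝ}
    (hφ : ContDiffOn ℝ ∞ φ U) : ContDiffOn ℝ ∞ (Coord.pd k φ) U := by
  have h1 : ContDiffOn ℝ ∞ (fderiv ℝ φ) U := hφ.fderiv_of_isOpen hU (by simp)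
  exact h1.clm_apply contDiffOn_const

lemma pd_congr (hU : IsOpen U) (k : Fin n) {φ ψ : EuclideanSpace ℝ (Fin n) → ℝ}
    (h : ∀ y ∈ U, φ y = ψ y) {y : EuclideanSpace ℝ (Fin n)} (hy : y ∈ U) :
    Coord.pd k φ y = Coord.pd k ψ y := by
  have h1 : φ =ᶠ[nhds y] ψ := Filter.eventually_of_mem (hU.mem_nhds hy) h
  rw [Coord.pd, Coord.pd, h1.fderiv_eq]

/-- The derivation of the ring of smooth functions that a partial derivative defines. -/
noncomputable def D (hU : IsOpen U) (k : Fin n) : Derivation ℝ (smoothRing U) (smoothRing U) :=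
  have hd : ∀ (f : smoothRing U) (u : U), DifferentiableAt ℝ (zeroExt f) u := fun f u =>
    ((contDiffOn_zeroExt f).contDiffAt (hU.mem_nhds u.2)).differentiableAt (by simp)
  Derivation.mk'
    { toFun := fun f => ofFun (Coord.pd k (zeroExt f)) (contDiffOn_pd hU k (contDiffOn_zeroExt f))
      map_add' := fun f f' => ext_ev fun u => by
        simp only [ev_ofFun, map_add]
        rw [pd_congr hU k (ψ := fun y => (zeroExt f) y + (zeroExt f') y) _ u.2]
        · simp only [Coord.pd]
          rw [fderiv_fun_add (hd f u) (hd f' u)]; rfl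
        · intro y hy
          simpa using zeroExt_apply (f + f') ⟨y, hy⟩ |>.trans (by
            rw [map_add, ← zeroExt_apply, ← zeroExt_apply])
      map_smul' := fun c f => ext_ev fun u => by
        simp only [ev_ofFun, ev_smul, RingHom.id_apply]
        rw [pd_congr hU k (ψ := fun y => c * (zeroExt f) y) _ u.2]
        · simp only [Coord.pd]
          rw [fderiv_const_mul (hd f u)]; rfl
        · intro y hy
          simpa using zeroExt_apply (c • f) ⟨y, hy⟩ |>.trans (by rw [ev_smul, ← zeroExt_apply]) }
    fun f f' => ext_ev fun u => by
      simp only [LinearMap.coe_mk, AddHom.coe_mk, smul_eq_mul, ev_ofFun, map_add, map_mul]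
      rw [pd_congr hU k (ψ := fun y => (zeroExt f) y * (zeroExt f') y) _ u.2]
      · simp only [Coord.pd]
        rw [fderiv_fun_mul (hd f u) (hd f' u), ← zeroExt_apply, ← zeroExt_apply]; rfl
      · intro y hy
        simpa using zeroExt_apply (f * f') ⟨y, hy⟩ |>.trans (by
          rw [map_mul, ← zeroExt_apply, ← zeroExt_apply])

lemma ev_D (hU : IsOpen U) (k : Fin n) (f : smoothRing U) (u : U) :
    ev u (D hU k f) = Coord.pd k (zeroExt f) u := rfl

/-- A partial derivative in `U` of a function that agrees on `U` with a ring element. -/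
lemma pd_eq (hU : IsOpen U) (k : Fin n) (f : smoothRing U) {φ : EuclideanSpace ℝ (Fin n) → ℝ}
    (h : ∀ u : U, φ u = ev u f) (u : U) : Coord.pd k φ u = ev u (D hU k f) := by
  rw [ev_D]
  exact pd_congr hU k (fun y hy => (h ⟨y, hy⟩).trans (zeroExt_apply f ⟨y, hy⟩).symm) u.2

lemma D_comm (hU : IsOpen U) (i j : Fin n) (f : smoothRing U) :
    D hU i (D hU j f) = D hU j (D hU i f) := by
  refine ext_ev fun u => ?_
  have hc : ContDiffAt ℝ ∞ (zeroExt f) u := (contDiffOn_zeroExt f).contDiffAt (hU.mem_nhds u.2)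
  have hs : IsSymmSndFDerivAt ℝ (zeroExt f) u := hc.isSymmSndFDerivAt (by
    rw [minSmoothness_of_isRCLikeNormedField]; exact WithTop.coe_le_coe.2 le_top)
  have hd : DifferentiableAt ℝ (fderiv ℝ (zeroExt f)) u :=
    (hc.fderiv_right (m := 1) (by norm_cast)).differentiableAt (by simp)
  have h1 : ∀ i j, ev u (D hU i (D hU j f)) = fderiv ℝ (fderiv ℝ (zeroExt f)) u
      (EuclideanSpace.single i 1) (EuclideanSpace.single j 1) := fun i j => by
    rw [← pd_eq hU i (D hU j f) (φ := Coord.pd j (zeroExt f)) (fun u => (ev_D hU j f u).symm)]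
    unfold Coord.pd
    rw [fderiv_clm_apply hd (by fun_prop)]
    simp
  rw [h1, h1]
  exact hs _ _

lemma isUnit_of_forall_ne_zero {f : smoothRing U} (hf : ∀ u, ev u f ≠ 0) : IsUnit f := by
  refine IsUnit.of_mul_eq_one (ofFun (fun y => ((zeroExt f) y)⁻¹)
    ((contDiffOn_zeroExt f).inv fun y hy => ?_)) (ext_ev fun u => ?_)
  · rw [zeroExt_apply f ⟨y, hy⟩]; exact hf _
  · rw [map_mul, ev_ofFun, zeroExt_apply, map_one, mul_inv_cancel₀ (hf u)]

end smoothRing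

end SmoothRing

/-! ### The coordinate tensor calculus in terms of the ring of smooth functions -/

/-- A smooth nondegenerate metric on an open subset of a coordinate space. -/
structure Coord.IsMetricOn {n : ℕ} (G : Coord.Metric n) (U : Set (EuclideanSpace ℝ (Fin n))) :
    Prop where
  isOpen : IsOpen U
  smooth : ∀ i j, ContDiffOn ℝ ∞ (fun y => G y i j) U
  symm : ∀ y ∈ U, ∀ i j, G y i j = G y j i
  det_ne_zero : ∀ y ∈ U, (G y).det ≠ 0

namespace Coord.IsMetricOn

open smoothRing

variable {n : ℕ} {G : Coord.Metric n} {U : Set (EuclideanSpace ℝ (Fin n))}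
  (hG : Coord.IsMetricOn G U)

/-- The matrix of the metric over the ring of smooth functions. -/
def gMatrix : Matrix (Fin n) (Fin n) (smoothRing U) :=
  Matrix.of fun i j => ofFun (fun y => G y i j) (hG.smooth i j)

lemma map_gMatrix (u : U) : hG.gMatrix.map (ev u) = G u := rfl

lemma isUnit_det_gMatrix : IsUnit hG.gMatrix.det := by
  refine isUnit_of_forall_ne_zero fun u => ?_
  rw [RingHom.map_det, RingHom.mapMatrix_apply, map_gMatrix]
  exact hG.det_ne_zero u u.2

/-- The metric as a metric over the differential ring of smooth functions. -/
noncomputable def formal : FormalMetric (Fin n) (smoothRing U) where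
  D := D hG.isOpen
  D_comm := D_comm hG.isOpen
  g := hG.gMatrix
  h := hG.gMatrix⁻¹
  g_symm := fun i j => ext_ev fun u => hG.symm u u.2 i j
  g_mul_h := Matrix.mul_nonsing_inv _ hG.isUnit_det_gMatrix

lemma ev_g (u : U) (i j : Fin n) : ev u (hG.formal.g i j) = G u i j := rfl

lemma ev_h (u : U) (i j : Fin n) : ev u (hG.formal.h i j) = (G u)⁻¹ i j := by
  have h1 : (hG.formal.g * hG.formal.h).map (ev u) = 1 := by
    rw [hG.formal.g_mul_h, Matrix.map_one _ (map_zero _) (map_one _)]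
  rw [Matrix.map_mul] at h1
  have h2 := Matrix.inv_eq_right_inv h1
  have h3 : hG.formal.g.map (ev u) = G u := rfl
  rw [h3] at h2
  rw [h2]; rfl

/-- Partial derivatives of a function that agrees on `U` with a ring element. -/
lemma pd_eq (k : Fin n) (f : smoothRing U) {φ : EuclideanSpace ℝ (Fin n) → ℝ}
    (h : ∀ u : U, φ u = ev u f) (u : U) : Coord.pd k φ u = ev u (hG.formal.D k f) :=
  smoothRing.pd_eq hG.isOpen k f h u

lemma christoffel_eq (u : U) (c a b : Fin n) :
    Coord.christoffel G u c a b = ev u (hG.formal.Γ a c b) := by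
  have h1 : ∀ k i j, Coord.pd k (fun z => G z i j) u = ev u (hG.formal.D k (hG.formal.g i j)) :=
    fun k i j => hG.pd_eq k _ (fun _ => rfl) u
  simp only [Coord.christoffel, FormalMetric.Γ, Matrix.mul_apply, FormalMetric.lowChristoffel,
    map_sum, map_mul, ev_smul, map_add, map_sub, h1, ev_h, Finset.mul_sum]
  exact Finset.sum_congr rfl fun _ _ => by ring

lemma riemannUp_eq (u : U) (a b c d : Fin n) :
    Coord.riemannUp G u a b c d = ev u (hG.formal.Rm c d a b) := by
  have h1 : ∀ k a c b, Coord.pd k (fun z => Coord.christoffel G z a c b) u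
      = ev u (hG.formal.D k (hG.formal.Γ c a b)) :=
    fun k a c b => hG.pd_eq k _ (fun v => hG.christoffel_eq v a c b) u
  simp only [Coord.riemannUp, FormalMetric.Rm, Matrix.add_apply, Matrix.sub_apply,
    FormalMetric.dM, Matrix.map_apply, Matrix.mul_apply, map_add, map_sub, map_sum, map_mul, h1,
    christoffel_eq hG, Finset.sum_sub_distrib]

lemma riemann_eq (u : U) (a b c d : Fin n) :
    Coord.riemann G u a b c d = ev u (hG.formal.Riem a b c d) := by
  simp only [Coord.riemann, FormalMetric.Riem, Matrix.mul_apply, map_sum, map_mul,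
    hG.riemannUp_eq, ev_g]

lemma ev_ctr (u : U) (t : Fin n → Fin n → smoothRing U) :
    ev u (hG.formal.ctr t) = ∑ c, ∑ d, (G u)⁻¹ c d * ev u (t c d) := by
  simp only [FormalMetric.ctr, map_sum, map_mul, ev_h]

lemma Ric_eq_sum (b d : Fin n) : hG.formal.Ric b d = ∑ a, hG.formal.Rm a d a b := by
  have h1 : ∀ c, (hG.formal.h * (hG.formal.g * hG.formal.Rm c d)) c b = hG.formal.Rm c d c b :=
    fun c => by rw [← mul_assoc, hG.formal.h_mul_g, one_mul]
  rw [FormalMetric.Ric, ← FormalMetric.ctr_swap]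
  simp only [FormalMetric.ctr, FormalMetric.Riem, ← h1]
  exact Finset.sum_congr rfl fun c _ => by rw [Matrix.mul_apply]

lemma ricci_eq (u : U) (b d : Fin n) : Coord.ricci G u b d = ev u (hG.formal.Ric b d) := by
  simp only [Coord.ricci, hG.riemannUp_eq, Ric_eq_sum, map_sum]

lemma nabla_two (G : Coord.Metric n) (T : Coord.TField n 2) (y : EuclideanSpace ℝ (Fin n))
    (a b c : Fin n) : Coord.nabla G T y ![a, b, c] = Coord.pd c (fun z => T z ![a, b]) y
      - (∑ p, Coord.christoffel G y p c a * T y ![p, b]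
        + ∑ p, Coord.christoffel G y p c b * T y ![a, p]) := by
  have h1 : (fun i : Fin 2 => ![a, b, c] i.castSucc) = ![a, b] := by
    ext i; fin_cases i <;> rfl
  have h2 : ∀ p, Function.update ![a, b] 0 p = ![p, b] := fun p => by
    ext i; fin_cases i <;> rfl
  have h3 : ∀ p, Function.update ![a, b] 1 p = ![a, p] := fun p => by
    ext i; fin_cases i <;> rfl
  simp only [Coord.nabla, Fin.sum_univ_two, h1, h2, h3]
  rfl

lemma nabla_one (G : Coord.Metric n) (T : Coord.TField n 1) (y : EuclideanSpace ℝ (Fin n))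
    (a b : Fin n) : Coord.nabla G T y ![a, b] = Coord.pd b (fun z => T z ![a]) y
      - ∑ p, Coord.christoffel G y p b a * T y ![p] := by
  have h1 : (fun i : Fin 1 => ![a, b] i.castSucc) = ![a] := by
    ext i; fin_cases i; rfl
  have h2 : ∀ p, Function.update ![a] 0 p = ![p] := fun p => by
    ext i; fin_cases i; rfl
  simp only [Coord.nabla, Fin.sum_univ_one, h1, h2]
  rfl

lemma divergence_eq {T : Coord.TField n 2} {t : Fin n → Fin n → smoothRing U}
    (hT : ∀ (u : U) a b, T u ![a, b] = ev u (t a b)) (u : U) (a : Fin n) :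
    Coord.divergence G T u a = ev u (hG.formal.div2 t a) := by
  have h1 : ∀ b c, Coord.nabla G T u ![a, b, c] = ev u (hG.formal.cov2 t c a b) := fun b c => by
    rw [nabla_two, hG.pd_eq c (t a b) (fun v => hT v a b)]
    simp only [FormalMetric.cov2, FormalMetric.act, map_sub, map_sum, map_mul, hT,
      hG.christoffel_eq, sub_add_eq_sub_sub]
  simp only [Coord.divergence, FormalMetric.div2, ev_ctr, h1]

lemma nabla_one_eq {T : Coord.TField n 1} {t : Fin n → smoothRing U}
    (hT : ∀ (u : U) a, T u ![a] = ev u (t a)) (u : U) (a b : Fin n) :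
    Coord.nabla G T u ![a, b] = ev u (hG.formal.cov1 t b a) := by
  rw [nabla_one, hG.pd_eq b (t a) (fun v => hT v a)]
  simp only [FormalMetric.cov1, FormalMetric.act, map_sub, map_sum, map_mul, hT,
    hG.christoffel_eq]

end Coord.IsMetricOn

/-! ### Curvature expressions -/

namespace CurvExpr

/-- The expression for the Ricci tensor `R_{bd} = g^{ac} R_{abcd}`. The permutation puts the indices
to be contracted, `a` and `c`, into the last two places. -/
def ricci : CurvExpr 0 2 :=
  .contract (.perm (r := 4) ⟨![2, 0, 3, 1], ![1, 3, 0, 2], by decide, by decide⟩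
    (.riem 0 le_rfl))

/-- The expression `T_{ab} - x T^c{}_c g_{ab}`. It yields the Einstein tensor and, for a Ricci-flat
metric, the Gauss–Bonnet tensor. -/
def subTrace (x : ℝ) (T : CurvExpr 0 2) : CurvExpr 0 2 :=
  .add T (.smul (-x) (.tensor (s := 0) .metric (.contract (r := 0) T)))

/-- The expression for `R_{acde} R_b{}^{cde}`. The permutation arranges the eight indices of
`R_{acde} R_{bijk}` in the order `a b c i d j e k`, and each contraction removes the last pair. -/
def quad : CurvExpr 0 2 :=
  .contract (.contract (.contract (r := 6)
    (.perm (r := 8) ⟨![0, 2, 4, 6, 1, 3, 5, 7], ![0, 4, 1, 5, 2, 6, 3, 7], by decide, by decide⟩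
      (.tensor (r := 4) (s := 4) (.riem 0 le_rfl) (.riem 0 le_rfl)))))

end CurvExpr

namespace Coord.IsMetricOn

open smoothRing

variable {n : ℕ} {G : Coord.Metric n} {U : Set (EuclideanSpace ℝ (Fin n))}
  (hG : Coord.IsMetricOn G U)

lemma eval_ricci (u : U) (a b : Fin n) :
    CurvExpr.ricci.eval G u ![a, b] = ev u (hG.formal.Ric a b) := by
  simp only [FormalMetric.Ric, ev_ctr, ← hG.riemann_eq]
  rfl

lemma eval_quad (u : U) (a b : Fin n) :
    CurvExpr.quad.eval G u ![a, b] = ev u (hG.formal.quad a b) := by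
  simp only [FormalMetric.quad, ev_ctr, map_mul, ← hG.riemann_eq]
  rfl

lemma eval_subTrace {T : CurvExpr 0 2} {t : Fin n → Fin n → smoothRing U}
    (hT : ∀ (u : U) a b, T.eval G u ![a, b] = ev u (t a b)) (x : ℝ) (u : U) (a b : Fin n) :
    (T.subTrace x).eval G u ![a, b] =
      ev u (t a b - (x • hG.formal.ctr t) * hG.formal.g a b) := by
  have h0 : ∀ c d : Fin n, Fin.append (![] : Fin 0 → Fin n) ![c, d] = ![c, d] := fun c d => by
    ext i; fin_cases i <;> rfl
  have h1 : (CurvExpr.contract (r := 0) T).eval G u ![] = ev u (hG.formal.ctr t) := by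
    simp only [CurvExpr.eval, ev_ctr, ← hT, h0]
  have h2 : (T.subTrace x).eval G u ![a, b] = T.eval G u ![a, b]
      + -x * (G u a b * (CurvExpr.contract (r := 0) T).eval G u
        (fun i => ![a, b] (Fin.natAdd 2 i))) := rfl
  rw [h2, hT, Subsingleton.elim (fun i : Fin 0 => ![a, b] (Fin.natAdd 2 i)) ![], h1]
  simp only [map_sub, map_mul, ev_smul, ev_g]
  ring

end Coord.IsMetricOn

/-! ### Null frames -/

/-- The matrix `diag(1, …, -1, …, 1)` with the entry `-1` at the place `i₀`. -/
def minkowski {n : ℕ} (i₀ : Fin n) : Matrix (Fin n) (Fin n) ℝ :=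
  Matrix.of fun i j => if i = j then (if i = i₀ then -1 else 1) else 0

lemma dotProduct_minkowski_mulVec {n : ℕ} (i₀ : Fin n) (x y : Fin n → ℝ) :
    x ⬝ᵥ (minkowski i₀ *ᵥ y) = x ⬝ᵥ y - 2 * (x i₀ * y i₀) := by
  have h1 : minkowski i₀ *ᵥ y = y - (2 * y i₀) • Pi.single i₀ 1 := by
    ext i
    have h2 : (minkowski i₀ *ᵥ y) i = (if i = i₀ then -1 else 1) * y i := by
      simp [minkowski, Matrix.mulVec, dotProduct]
    rw [h2, Pi.sub_apply, Pi.smul_apply, smul_eq_mul, Pi.single_apply]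
    split_ifs with h
    · rw [h]; ring
    · ring
  rw [h1, dotProduct_sub, dotProduct_smul, dotProduct_single]
  simp only [smul_eq_mul]
  ring

/-- In Minkowski space, a nonzero null vector is the first vector of a null frame. Its second vector
is a multiple of the reflected vector, and the other ones form an orthonormal basis of the
Euclidean orthogonal complement of the null vector and the time axis. -/
lemma exists_isNullFrame_minkowski {n : ℕ} (i₀ : Fin n) (l : Fin n → ℝ) (hl : l ≠ 0)
    (hnull : l ⬝ᵥ (minkowski i₀ *ᵥ l) = 0) :
    2 ≤ n ∧ ∃ e : FrameLabel n → Fin n → ℝ, IsNullFrame (minkowski i₀) e ∧ e .l = l := by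
  have hin : ∀ x y : EuclideanSpace ℝ (Fin n), inner ℝ x y = x.ofLp ⬝ᵥ y.ofLp := fun x y => by
    rw [EuclideanSpace.inner_eq_star_dotProduct, dotProduct_comm]; rfl
  rw [dotProduct_minkowski_mulVec] at hnull
  have hl0 : l i₀ ≠ 0 := fun h => hl (dotProduct_self_eq_zero.mp (by rw [h] at hnull; linarith))
  set l' : EuclideanSpace ℝ (Fin n) := WithLp.toLp 2 l with hl'
  set t : EuclideanSpace ℝ (Fin n) := EuclideanSpace.single i₀ (1 : ℝ) with ht
  have htx : ∀ x : EuclideanSpace ℝ (Fin n), inner ℝ t x = x i₀ := fun x => by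
    rw [ht, EuclideanSpace.inner_single_left]; simp
  have hll : inner ℝ l' l' = 2 * (l i₀ * l i₀) := by rw [hin]; linarith
  have hind : LinearIndependent ℝ ![t, l'] := by
    rw [LinearIndependent.pair_iff]
    intro a b hab
    have h1 : a * 1 + b * l i₀ = 0 := by
      have := congrArg (fun x => inner ℝ t x) hab
      simp only [htx] at this
      simpa [ht, hl'] using this
    have h2 : a * l i₀ + b * (2 * (l i₀ * l i₀)) = 0 := by
      have := congrArg (fun x => inner ℝ l' x) hab
      simp only [inner_add_right, inner_smul_right, hll, inner_zero_right] at this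
      rw [real_inner_comm, htx] at this
      exact this
    have h3 : b * (l i₀ * l i₀) = 0 := by linear_combination h2 - l i₀ * h1
    have hb : b = 0 := by simpa [hl0] using h3
    subst hb
    exact ⟨by linarith, rfl⟩
  set W := Submodule.span ℝ (Set.range ![t, l']) with hW
  have hdim : Module.finrank ℝ W = 2 := by
    rw [hW, finrank_span_eq_card hind, Fintype.card_fin]
  have hdim2 : Module.finrank ℝ W + Module.finrank ℝ Wᗮ = n := by
    rw [W.finrank_add_finrank_orthogonal, finrank_euclideanSpace, Fintype.card_fin]
  have hn : 2 ≤ n := by omega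
  have hdim3 : Module.finrank ℝ Wᗮ = n - 2 := by omega
  refine ⟨hn, ?_⟩
  let b := (stdOrthonormalBasis ℝ Wᗮ).reindex (finCongr hdim3)
  let m : Fin (n - 2) → Fin n → ℝ := fun i => (b i : EuclideanSpace ℝ (Fin n)).ofLp
  let k : Fin n → ℝ := (1 / (2 * l i₀ ^ 2)) • (l - (2 * l i₀) • Pi.single i₀ 1)
  have ht_mem : t ∈ W := Submodule.subset_span ⟨0, rfl⟩
  have hl_mem : l' ∈ W := Submodule.subset_span ⟨1, rfl⟩
  have hm0 : ∀ i, m i i₀ = 0 := fun i => by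
    have := (b i).2 t ht_mem
    rwa [htx] at this
  have hlm : ∀ i, l ⬝ᵥ m i = 0 := fun i => by
    have := (b i).2 l' hl_mem
    rwa [hin] at this
  have hmm : ∀ i j, m i ⬝ᵥ m j = if i = j then 1 else 0 := fun i j => by
    rw [← hin]
    exact orthonormal_iff_ite.mp b.orthonormal i j
  have hk0 : k i₀ = -1 / (2 * l i₀) := by
    simp only [k, Pi.smul_apply, Pi.sub_apply, Pi.single_eq_same, smul_eq_mul]
    field_simp; ring
  have hkx : ∀ x : Fin n → ℝ, k ⬝ᵥ x = (1 / (2 * l i₀ ^ 2)) * (l ⬝ᵥ x - 2 * l i₀ * x i₀) :=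
    fun x => by simp [k, sub_dotProduct, smul_dotProduct]
  have hllv : l ⬝ᵥ l = 2 * l i₀ ^ 2 := by linarith
  have hlk : k ⬝ᵥ l = 0 := by rw [hkx, hllv]; ring
  have hkm : ∀ i, k ⬝ᵥ m i = 0 := fun i => by rw [hkx, hlm, hm0]; ring
  have hkk : k ⬝ᵥ k = 2 * (k i₀ * k i₀) := by
    rw [hkx, dotProduct_comm l, hlk, hk0]; field_simp; ring
  refine ⟨fun α => match α with
    | .l => l
    | .k => k
    | .m i => m i, ?_, rfl⟩
  intro α β
  rw [dotProduct_minkowski_mulVec]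
  rcases α with _ | _ | i <;> rcases β with _ | _ | j <;> simp only [FrameLabel.gram]
  · linarith
  · rw [dotProduct_comm, hlk, hk0]; field_simp; ring
  · rw [hlm, hm0]; ring
  · rw [hlk, hk0]; field_simp; ring
  · rw [hkk]; ring
  · rw [hkm, hm0]; ring
  · rw [dotProduct_comm, hlm, hm0]; ring
  · rw [dotProduct_comm, hkm, hm0]; ring
  · rw [hmm, hm0]; ring

/-- A nonzero null vector of a Lorentzian scalar product is the first vector of a null frame. -/
lemma exists_isNullFrame {n : ℕ} {A P : Matrix (Fin n) (Fin n) ℝ} {i₀ : Fin n}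
    (hPu : IsUnit P.det) (hP : Pᵀ * A * P = minkowski i₀) (l : Fin n → ℝ) (hl : l ≠ 0)
    (hnull : l ⬝ᵥ (A *ᵥ l) = 0) :
    2 ≤ n ∧ ∃ e : FrameLabel n → Fin n → ℝ, IsNullFrame A e ∧ e .l = l := by
  have h1 : ∀ x y : Fin n → ℝ, x ⬝ᵥ (minkowski i₀ *ᵥ y) = (P *ᵥ x) ⬝ᵥ (A *ᵥ (P *ᵥ y)) :=
    fun x y => by
      rw [← hP, ← Matrix.mulVec_mulVec, ← Matrix.mulVec_mulVec, Matrix.dotProduct_mulVec,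
        Matrix.vecMul_transpose]
  have h2 : P *ᵥ (P⁻¹ *ᵥ l) = l := by
    rw [Matrix.mulVec_mulVec, Matrix.mul_nonsing_inv _ hPu, Matrix.one_mulVec]
  obtain ⟨hn, e, he, hel⟩ := exists_isNullFrame_minkowski i₀ (P⁻¹ *ᵥ l)
    (fun h => hl (by rw [← h2, h, Matrix.mulVec_zero])) (by rw [h1, h2, hnull])
  refine ⟨hn, fun α => P *ᵥ e α, fun α β => ?_, ?_⟩
  · rw [← h1]; exact he α β
  · beta_reduce
    rw [hel, h2]

namespace FrameLabel

variable {n : ℕ}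

/-- Frame labels as the disjoint union of `{ℓ}`, `{n}` and the labels `m_i`. -/
def equivOption : FrameLabel n ≃ Option (Option (Fin (n - 2))) where
  toFun := fun
    | .l => none
    | .k => some none
    | .m i => some (some i)
  invFun := fun
    | none => .l
    | some none => .k
    | some (some i) => .m i
  left_inv := by rintro (_ | _ | _) <;> rfl
  right_inv := by rintro (_ | _ | _) <;> rfl

instance : Fintype (FrameLabel n) := Fintype.ofEquiv _ equivOption.symm

/-- The label of the dual frame vector: `ℓ` and `n` are interchanged. -/
def dual : FrameLabel n → FrameLabel n
  | .l => .k
  | .k => .l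
  | .m i => .m i

lemma boostWeight_dual (α : FrameLabel n) : α.dual.boostWeight = -α.boostWeight := by
  cases α <;> rfl

lemma dual_dual (α : FrameLabel n) : α.dual.dual = α := by cases α <;> rfl

end FrameLabel

/-! ### The boost order of a curvature tensor with vanishing square -/

section Frames

variable {n : ℕ} {A : Matrix (Fin n) (Fin n) ℝ} {e : FrameLabel n → Fin n → ℝ}

/-- The completeness relation of a null frame. It inverts the Gram matrix, which is square because
there are `n` frame labels if `2 ≤ n`. -/
lemma IsNullFrame.inv_apply (hn : 2 ≤ n) (he : IsNullFrame A e) (a b : Fin n) :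
    A⁻¹ a b = ∑ α, e α a * e α.dual b := by
  let E : Matrix (FrameLabel n) (Fin n) ℝ := Matrix.of e
  let E' : Matrix (FrameLabel n) (Fin n) ℝ := Matrix.of fun α => e α.dual
  have hcard : FrameLabel n ≃ Fin n := FrameLabel.equivOption.trans
    (Fintype.equivFinOfCardEq (by simp; omega))
  classical
  have h1 : E * (A * E'ᵀ) = 1 := by
    ext α β
    have h2 : (E * (A * E'ᵀ)) α β = α.gram β.dual := by
      rw [← he α β.dual]
      simp only [Matrix.mul_apply, dotProduct, Matrix.mulVec]
      rfl
    rw [h2, Matrix.one_apply]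
    rcases α with _ | _ | i <;> rcases β with _ | _ | j <;> simp [FrameLabel.gram, FrameLabel.dual]
  have h3 : A * E'ᵀ * E = 1 := (Matrix.mul_eq_one_comm_of_equiv hcard).mp h1
  rw [Matrix.mul_assoc] at h3
  rw [Matrix.inv_eq_right_inv h3, ← Equiv.sum_comp
    (⟨FrameLabel.dual, FrameLabel.dual, FrameLabel.dual_dual, FrameLabel.dual_dual⟩ :
      FrameLabel n ≃ FrameLabel n), Matrix.mul_apply]
  refine Finset.sum_congr rfl fun α _ => ?_
  simp [E, E', FrameLabel.dual_dual]

/-- The component of a tensor with respect to four vectors of a frame. -/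
def frameComp (C : Fin n → Fin n → Fin n → Fin n → ℝ) (e : FrameLabel n → Fin n → ℝ)
    (α β γ δ : FrameLabel n) : ℝ :=
  ∑ a, ∑ b, ∑ c, ∑ d, C a b c d * e α a * e β b * e γ c * e δ d

lemma IsNullFrame.contract_mul (hn : 2 ≤ n) (he : IsNullFrame A e) (s t : Fin n → ℝ) :
    ∑ c, ∑ d, A⁻¹ c d * (s c * t d) = ∑ α, (∑ c, s c * e α c) * (∑ d, t d * e α.dual d) := by
  calc ∑ c, ∑ d, A⁻¹ c d * (s c * t d)
      = ∑ c, ∑ d, ∑ α, (s c * e α c) * (t d * e α.dual d) :=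
        Finset.sum_congr rfl fun c _ => Finset.sum_congr rfl fun d _ => by
          rw [he.inv_apply hn, Finset.sum_mul]
          exact Finset.sum_congr rfl fun α _ => by ring
    _ = ∑ α, ∑ c, ∑ d, (s c * e α c) * (t d * e α.dual d) :=
        (Finset.sum_congr rfl fun c _ => Finset.sum_comm).trans Finset.sum_comm
    _ = _ := Finset.sum_congr rfl fun α _ => by rw [Finset.sum_mul_sum]

lemma IsNullFrame.contract_sum_mul (hn : 2 ≤ n) (he : IsNullFrame A e) {I : Type*} [Fintype I]
    (s t : I → Fin n → ℝ) : ∑ c, ∑ d, A⁻¹ c d * ∑ i, s i c * t i d =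
      ∑ p : FrameLabel n × I,
        (∑ c, s p.2 c * e p.1 c) * (∑ d, t p.2 d * e p.1.dual d) := by
  calc ∑ c, ∑ d, A⁻¹ c d * ∑ i, s i c * t i d
      = ∑ i, ∑ c, ∑ d, A⁻¹ c d * (s i c * t i d) := by
        simp only [Finset.mul_sum]
        exact (Finset.sum_congr rfl fun c _ => Finset.sum_comm).trans Finset.sum_comm
    _ = _ := by
        rw [Fintype.sum_prod_type_right]
        exact Finset.sum_congr rfl fun i _ => he.contract_mul hn (s i) (t i)

/-- The square of a tensor of rank 4 in terms of its components in a null frame. -/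
lemma IsNullFrame.contract_square (hn : 2 ≤ n) (he : IsNullFrame A e)
    (R : Fin n → Fin n → Fin n → Fin n → ℝ) :
    ∑ a, ∑ b, A⁻¹ a b * ∑ c, ∑ i, A⁻¹ c i * ∑ d, ∑ j, A⁻¹ d j * ∑ x, ∑ y, A⁻¹ x y *
        (R a c d x * R b i j y)
      = ∑ p : FrameLabel n × FrameLabel n × FrameLabel n × FrameLabel n,
        frameComp R e p.1 p.2.1 p.2.2.1 p.2.2.2 *
          frameComp R e p.1.dual p.2.1.dual p.2.2.1.dual p.2.2.2.dual := by
  have h1 : ∀ α β γ δ, frameComp R e α β γ δ =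
      ∑ a, (∑ b, (∑ c, (∑ d, R a b c d * e δ d) * e γ c) * e β b) * e α a := fun α β γ δ => by
    simp only [frameComp, Finset.sum_mul]
    refine Finset.sum_congr rfl fun a _ => Finset.sum_congr rfl fun b _ =>
      Finset.sum_congr rfl fun c _ => Finset.sum_congr rfl fun d _ => by ring
  simp only [h1]
  rw [← he.contract_sum_mul hn
    (fun (p : FrameLabel n × FrameLabel n × FrameLabel n) a =>
      ∑ b, (∑ c, (∑ d, R a b c d * e p.2.2 d) * e p.2.1 c) * e p.1 b)
    (fun (p : FrameLabel n × FrameLabel n × FrameLabel n) a =>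
      ∑ b, (∑ c, (∑ d, R a b c d * e p.2.2.dual d) * e p.2.1.dual c) * e p.1.dual b)]
  refine Finset.sum_congr rfl fun a _ => Finset.sum_congr rfl fun b _ => ?_
  rw [← he.contract_sum_mul hn
    (fun (p : FrameLabel n × FrameLabel n) c =>
      ∑ d, (∑ x, R a c d x * e p.2 x) * e p.1 d)
    (fun (p : FrameLabel n × FrameLabel n) i =>
      ∑ d, (∑ x, R b i d x * e p.2.dual x) * e p.1.dual d)]
  congr 1
  refine Finset.sum_congr rfl fun c _ => Finset.sum_congr rfl fun i _ => ?_
  rw [← he.contract_sum_mul hn (fun (p : FrameLabel n) d => ∑ x, R a c d x * e p x)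
    (fun (p : FrameLabel n) d => ∑ x, R b i d x * e p.dual x)]
  congr 1
  refine Finset.sum_congr rfl fun d _ => Finset.sum_congr rfl fun j _ => ?_
  rw [he.contract_mul hn]

/-- A Riemann-like tensor `R` with `ℓ^a R_{abcd} = ℓ_b (v_d ℓ_c - v_c ℓ_d)`, where `v` is orthogonal
to the null vector `ℓ`, and with vanishing square has boost order at most `-1`: the components of
non-negative boost weight that involve `ℓ` vanish, so that the square is the sum of the squares of
the components `R_{ijkl}` along the spacelike vectors of the frame. -/
lemma IsNullFrame.boostOrderLE_neg_one (hn : 2 ≤ n) (he : IsNullFrame A e)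
    {R : Fin n → Fin n → Fin n → Fin n → ℝ} (hleft : ∀ a b c d, R a b c d = -R b a c d)
    (hpair : ∀ a b c d, R a b c d = R c d a b) {lo v : Fin n → ℝ}
    (hlo : ∀ α, ∑ b, lo b * e α b = FrameLabel.gram .l α) (hv : ∑ d, v d * e .l d = 0)
    (hR : ∀ b c d, ∑ a, e .l a * R a b c d = lo b * (v d * lo c - v c * lo d))
    (hsq : ∑ a, ∑ b, A⁻¹ a b * ∑ c, ∑ i, A⁻¹ c i * ∑ d, ∑ j, A⁻¹ d j * ∑ x, ∑ y, A⁻¹ x y *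
        (R a c d x * R b i j y) = 0) : BoostOrderLE R e (-1) := by
  set V : FrameLabel n → ℝ := fun δ => ∑ d, v d * e δ d with hV
  have hVl : V .l = 0 := hv
  have f1 : ∀ β γ δ, frameComp R e .l β γ δ = FrameLabel.gram .l β *
      (V δ * FrameLabel.gram .l γ - V γ * FrameLabel.gram .l δ) := fun β γ δ => by
    calc frameComp R e .l β γ δ
        = ∑ b, ∑ c, ∑ d, (∑ a, e .l a * R a b c d) * e β b * e γ c * e δ d := by
          simp only [frameComp, Finset.sum_mul]
          rw [Finset.sum_comm]
          refine Finset.sum_congr rfl fun b _ => ?_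
          rw [Finset.sum_comm]
          refine Finset.sum_congr rfl fun c _ => ?_
          rw [Finset.sum_comm]
          exact Finset.sum_congr rfl fun d _ => Finset.sum_congr rfl fun a _ => by ring
      _ = (∑ b, lo b * e β b) * ((∑ c, lo c * e γ c) * (∑ d, v d * e δ d)
            - (∑ c, v c * e γ c) * (∑ d, lo d * e δ d)) := by
          rw [Finset.sum_mul_sum, Finset.sum_mul_sum]
          simp only [← Finset.sum_sub_distrib]
          rw [Finset.sum_mul]
          refine Finset.sum_congr rfl fun b _ => ?_
          rw [Finset.mul_sum]
          refine Finset.sum_congr rfl fun c _ => ?_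
          rw [Finset.mul_sum]
          exact Finset.sum_congr rfl fun d _ => by rw [hR]; ring
      _ = _ := by rw [hlo, hlo, hlo]; simp only [hV]; ring
  have f2 : ∀ α β γ δ, frameComp R e α β γ δ = -frameComp R e β α γ δ := fun α β γ δ => by
    simp only [frameComp]
    rw [Finset.sum_comm]
    simp only [← Finset.sum_neg_distrib]
    refine Finset.sum_congr rfl fun a _ => Finset.sum_congr rfl fun b _ =>
      Finset.sum_congr rfl fun c _ => Finset.sum_congr rfl fun d _ => ?_
    rw [hleft]; ring
  have f3 : ∀ α β γ δ, frameComp R e α β γ δ = frameComp R e γ δ α β := fun α β γ δ => by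
    have h1 : ∀ f : Fin n → Fin n → Fin n → Fin n → ℝ,
        ∑ a, ∑ b, ∑ c, ∑ d, f a b c d = ∑ c, ∑ d, ∑ a, ∑ b, f a b c d := fun f => by
      have h2 : ∑ p : Fin n × Fin n, ∑ q : Fin n × Fin n, f p.1 p.2 q.1 q.2
          = ∑ q : Fin n × Fin n, ∑ p : Fin n × Fin n, f p.1 p.2 q.1 q.2 := Finset.sum_comm
      simpa only [Fintype.sum_prod_type] using h2
    simp only [frameComp]
    rw [h1]
    refine Finset.sum_congr rfl fun a _ => Finset.sum_congr rfl fun b _ =>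
      Finset.sum_congr rfl fun c _ => Finset.sum_congr rfl fun d _ => ?_
    rw [hpair]; ring
  -- A component of non-negative boost weight either has spacelike labels only or has a label `ℓ`.
  -- In the latter case the symmetries of `R` move `ℓ` to the first place, and `f1` applies.
  have f4 : ∀ α β γ δ : FrameLabel n,
      0 ≤ α.boostWeight + β.boostWeight + γ.boostWeight + δ.boostWeight →
      (∃ i j k l, α = .m i ∧ β = .m j ∧ γ = .m k ∧ δ = .m l) ∨ frameComp R e α β γ δ = 0 := by
    have g2 : ∀ α γ δ, frameComp R e α .l γ δ = -frameComp R e .l α γ δ := fun _ _ _ => f2 _ _ _ _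
    have g3 : ∀ α β δ, frameComp R e α β .l δ = frameComp R e .l δ α β := fun _ _ _ => f3 _ _ _ _
    have g4 : ∀ α β γ, frameComp R e α β γ .l = -frameComp R e .l γ α β := fun α β γ => by
      rw [f3, f2]
    intro α β γ δ hw
    rcases α with _ | _ | i <;> rcases β with _ | _ | j <;> rcases γ with _ | _ | k <;>
      rcases δ with _ | _ | l <;>
      first
      | exact Or.inl ⟨_, _, _, _, rfl, rfl, rfl, rfl⟩
      | (exfalso; revert hw; simp only [FrameLabel.boostWeight]; norm_num; done)
      | (right; simp only [f1, g2, g3, g4, FrameLabel.gram, hVl]; ring)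
  rw [he.contract_square hn] at hsq
  -- The factors of each term have opposite boost weights, so that `f4` applies to one of them.
  have f5 : ∀ p ∈ (Finset.univ : Finset (FrameLabel n × FrameLabel n × FrameLabel n × FrameLabel n)),
      0 ≤ frameComp R e p.1 p.2.1 p.2.2.1 p.2.2.2 *
          frameComp R e p.1.dual p.2.1.dual p.2.2.1.dual p.2.2.2.dual := by
    rintro ⟨α, β, γ, δ⟩ -
    rcases le_total 0 (α.boostWeight + β.boostWeight + γ.boostWeight + δ.boostWeight) with hw | hw
    · rcases f4 α β γ δ hw with ⟨i, j, k, l, rfl, rfl, rfl, rfl⟩ | h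
      · exact mul_self_nonneg _
      · simp [h]
    · rcases f4 α.dual β.dual γ.dual δ.dual (by
        simp only [FrameLabel.boostWeight_dual]; linarith) with ⟨i, j, k, l, h1, h2, h3, h4⟩ | h
      · rw [← α.dual_dual, ← β.dual_dual, ← γ.dual_dual, ← δ.dual_dual, h1, h2, h3, h4]
        exact mul_self_nonneg _
      · simp [h]
  rw [Finset.sum_eq_zero_iff_of_nonneg f5] at hsq
  intro α β γ δ hw
  rcases f4 α β γ δ (by omega) with ⟨i, j, k, l, rfl, rfl, rfl, rfl⟩ | h
  · exact mul_self_eq_zero.mp (hsq ⟨.m i, .m j, .m k, .m l⟩ (Finset.mem_univ _))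
  · exact h

end Frames

/-! ### Ricci-flat metrics with a recurrent null covector, in coordinates -/

namespace Coord.IsMetricOn

open smoothRing

variable {n : ℕ} {G : Coord.Metric n} {U : Set (EuclideanSpace ℝ (Fin n))}
  (hG : Coord.IsMetricOn G U)

/-- The recurrence function of a smooth nowhere vanishing recurrent covector is smooth. -/
lemma exists_recurrence (lo : Fin n → smoothRing U) (hne : ∀ u, ∃ a, ev u (lo a) ≠ 0) (L : U → ℝ)
    (hL : ∀ u a b, ev u (hG.formal.cov1 lo b a) = L u * ev u (lo a) * ev u (lo b)) :
    ∃ L' : smoothRing U, ∀ a b, hG.formal.cov1 lo b a = L' * lo a * lo b := by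
  have hpos : ∀ u, ev u (∑ a, lo a * lo a) ≠ 0 := fun u => by
    obtain ⟨a, ha⟩ := hne u
    simp only [map_sum, map_mul]
    exact (Finset.sum_pos' (fun i _ => mul_self_nonneg (ev u (lo i)))
      ⟨a, Finset.mem_univ _, mul_self_pos.mpr ha⟩).ne'
  obtain ⟨q, hq⟩ := isUnit_of_forall_ne_zero hpos
  have hqu : ∀ u, ev u (↑q⁻¹ : smoothRing U) * ev u (∑ a, lo a * lo a) = 1 := fun u => by
    rw [← hq, ← map_mul, Units.inv_mul, map_one]
  -- The coordinate sum of squares `q` of `l_a` has no zero, and `L = q⁻² ∑ l_{a;b} l_a l_b`.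
  refine ⟨↑q⁻¹ * ↑q⁻¹ * ∑ a, ∑ b, hG.formal.cov1 lo b a * (lo a * lo b),
    fun a b => ext_ev fun u => ?_⟩
  have h1 : ev u (∑ a, ∑ b, hG.formal.cov1 lo b a * (lo a * lo b))
      = L u * (ev u (∑ a, lo a * lo a) * ev u (∑ a, lo a * lo a)) := by
    simp only [map_sum, map_mul, hL]
    rw [Finset.sum_mul_sum]
    simp only [Finset.mul_sum]
    exact Finset.sum_congr rfl fun _ _ => Finset.sum_congr rfl fun _ _ => by ring
  rw [hL, map_mul, map_mul, map_mul, map_mul, h1]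
  linear_combination (-(L u * ev u (lo a) * ev u (lo b)
    * (ev u (↑q⁻¹ : smoothRing U) * ev u (∑ a, lo a * lo a) + 1))) * hqu u

lemma weyl_eq_riemann (u : U) (hRic : ∀ a b, Coord.ricci G u a b = 0) :
    Coord.weyl G u = Coord.riemann G u := by
  have h1 : Coord.scalarCurv G u = 0 := by simp [Coord.scalarCurv, hRic]
  funext a b c d
  simp [Coord.weyl, h1, hRic]

/-- If the Gauss–Bonnet tensor is proportional to the metric at a point, then the Weyl tensor has
boost order at most `-1` there. -/
lemma exists_boostOrderLE_neg_one {lo : Fin n → smoothRing U} {L : smoothRing U}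
    (hrec : ∀ a b, hG.formal.cov1 lo b a = L * lo a * lo b)
    (hnull : hG.formal.dot lo lo = 0) (hne : ∀ u, ∃ a, ev u (lo a) ≠ 0)
    (hRic : ∀ a b, hG.formal.Ric a b = 0) (u : U)
    (hc : ∃ c, ∀ a b, ev u (hG.formal.quad a b) = c * G u a b)
    (hP : ∃ (P : Matrix (Fin n) (Fin n) ℝ) (i₀ : Fin n), IsUnit P.det ∧
      Pᵀ * G u * P = minkowski i₀) :
    ∃ e, IsNullFrame (G u) e ∧ BoostOrderLE (Coord.weyl G u) e (-1) := by
  set v : Fin n → smoothRing U := fun d => hG.formal.D d L with hvdef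
  have hR : ∀ b c d, hG.formal.dot lo (fun a => hG.formal.Riem a b c d)
      = lo b * (v d * lo c - v c * lo d) := fun b c d => by
    rw [FormalMetric.dot_Riem, FormalMetric.sum_mul_Rm_of_recurrent _ lo L hrec]
  have hv : hG.formal.dot v lo = 0 := ext_ev fun w => by
    obtain ⟨b, hb⟩ := hne w
    have h1 := congrArg (ev w) (hG.formal.mul_dot_eq_zero hR hnull hRic b)
    rw [map_mul, map_zero] at h1
    rw [map_zero]
    exact (mul_eq_zero.mp h1).resolve_left hb
  have hdet : IsUnit (G u).det := (hG.det_ne_zero u u.2).isUnit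
  have hsymm : (G u)ᵀ = G u := by ext i j; exact hG.symm u u.2 j i
  -- the covector and the null vector at the point
  set x : Fin n → ℝ := fun a => ev u (lo a) with hx
  set lu : Fin n → ℝ := (G u)⁻¹ *ᵥ x with hlu
  have hGlu : G u *ᵥ lu = x := by
    rw [hlu, Matrix.mulVec_mulVec, Matrix.mul_nonsing_inv _ hdet, Matrix.one_mulVec]
  have hinv : ∀ a b, (G u)⁻¹ a b = (G u)⁻¹ b a := fun a b => by
    conv_lhs => rw [← hsymm, ← Matrix.transpose_nonsing_inv]
    rfl
  have hdot : ∀ t : Fin n → smoothRing U, ev u (hG.formal.dot lo t) = ∑ a, lu a * ev u (t a) :=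
    fun t => by
      rw [FormalMetric.dot, ev_ctr, Finset.sum_comm]
      refine Finset.sum_congr rfl fun a _ => ?_
      simp only [hlu, Matrix.mulVec, dotProduct, Finset.sum_mul, map_mul]
      exact Finset.sum_congr rfl fun p _ => by rw [hinv a p, mul_assoc]
  have hlu0 : lu ≠ 0 := fun h => by
    obtain ⟨a, ha⟩ := hne u
    rw [h, Matrix.mulVec_zero] at hGlu
    exact ha (congrFun hGlu.symm a)
  have hlunull : lu ⬝ᵥ (G u *ᵥ lu) = 0 := by
    rw [hGlu]
    exact (hdot lo).symm.trans (by rw [hnull, map_zero])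
  obtain ⟨P, i₀, hPu, hPG⟩ := hP
  obtain ⟨hn, e, he, hel⟩ := exists_isNullFrame hPu hPG lu hlu0 hlunull
  refine ⟨e, he, ?_⟩
  -- the contraction with the null vector shows that the quadratic tensor vanishes
  have hquad : ∀ a b, ev u (hG.formal.quad a b) = 0 := by
    obtain ⟨c, hc⟩ := hc
    have hc0 : c = 0 := by
      obtain ⟨b, hb⟩ := hne u
      have h1 := hdot (fun a => hG.formal.quad a b)
      rw [hG.formal.dot_quad hR hnull hv, map_zero] at h1
      have h2 : ∑ a, lu a * ev u (hG.formal.quad a b) = c * x b := by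
        rw [← hGlu]
        simp only [hc, Matrix.mulVec, dotProduct, Finset.mul_sum]
        exact Finset.sum_congr rfl fun a _ => by rw [hG.symm u u.2 a b]; ring
      rw [h2] at h1
      exact (mul_eq_zero.mp h1.symm).resolve_right hb
    intro a b
    rw [hc, hc0, zero_mul]
  rw [weyl_eq_riemann u fun a b => by rw [hG.ricci_eq, hRic, map_zero]]
  refine he.boostOrderLE_neg_one hn (lo := x) (v := fun d => ev u (v d)) ?_ ?_ ?_ ?_ ?_ ?_
  · intro a b c d
    rw [hG.riemann_eq, hG.riemann_eq, FormalMetric.Riem_swap_left, map_neg]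
  · intro a b c d
    rw [hG.riemann_eq, hG.riemann_eq, FormalMetric.Riem_pair]
  · intro α
    rw [← he .l α, hel, Matrix.dotProduct_mulVec, ← Matrix.mulVec_transpose, hsymm, hGlu]
    rfl
  · rw [hel]
    have h1 := hdot v
    rw [FormalMetric.dot_comm, hv, map_zero] at h1
    rw [h1]
    exact Finset.sum_congr rfl fun _ _ => mul_comm _ _
  · intro b c d
    have h1 := hdot (fun a => hG.formal.Riem a b c d)
    rw [hR] at h1
    simp only [hel, hG.riemann_eq]
    rw [← h1]
    simp only [map_mul, map_sub, hx]
  · have h1 : ev u (hG.formal.ctr hG.formal.quad) = 0 := by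
      simp only [ev_ctr, hquad, mul_zero, Finset.sum_const_zero]
    rw [← h1]
    simp only [ev_ctr, FormalMetric.quad, map_mul, ← hG.riemann_eq]

end Coord.IsMetricOn

/-! ### Lorentzian manifolds in charts -/

namespace LorentzMetric

open smoothRing

variable {n : ℕ} {M : Type*} [TopologicalSpace M] [ChartedSpace (EuclideanSpace ℝ (Fin n)) M]

lemma AdmitsCovariantlyConstantNullVector.admitsRecurrentNullVector {g : LorentzMetric n M}
    (hcc : g.AdmitsCovariantlyConstantNullVector) : g.AdmitsRecurrentNullVector := by
  obtain ⟨l, hl, hL⟩ := hcc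
  exact ⟨l, hl, 0, fun e he y hy a b => by rw [hL e he y hy a b]; simp⟩

variable [IsManifold (𝓡 n) ∞ M]

/-- The coordinate vectors of a chart of the atlas form a basis of the tangent space. -/
lemma exists_basis_coordVec {e : OpenPartialHomeomorph M (EuclideanSpace ℝ (Fin n))}
    (he : e ∈ atlas (EuclideanSpace ℝ (Fin n)) M) {y : EuclideanSpace ℝ (Fin n)}
    (hy : y ∈ e.target) :
    ∃ b : Module.Basis (Fin n) ℝ (TangentSpace (𝓡 n) (e.symm y)), ∀ i, b i = coordVec e y i := by
  have : IsManifold (𝓡 n) 1 M := IsManifold.of_le (n := ∞) (by norm_cast)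
  have hd := (mdifferentiable_of_mem_atlas (I := 𝓡 n) he).symm
  let φ := hd.mfderiv (x := y) hy
  let b : Module.Basis (Fin n) ℝ (TangentSpace (𝓡 n) y) :=
    (EuclideanSpace.basisFun (Fin n) ℝ).toBasis
  refine ⟨b.map φ.toLinearEquiv, fun i => ?_⟩
  have hb : (EuclideanSpace.basisFun (Fin n) ℝ).toBasis i = EuclideanSpace.single i (1 : ℝ) := by
    rw [OrthonormalBasis.coe_toBasis, EuclideanSpace.basisFun_apply]
  rw [Module.Basis.map_apply]
  exact congrArg φ hb

variable (g : LorentzMetric n M)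

lemma exists_transpose_mul_comp_mul {e : OpenPartialHomeomorph M (EuclideanSpace ℝ (Fin n))}
    (he : e ∈ atlas (EuclideanSpace ℝ (Fin n)) M) {y : EuclideanSpace ℝ (Fin n)}
    (hy : y ∈ e.target) : ∃ (P : Matrix (Fin n) (Fin n) ℝ) (i₀ : Fin n), IsUnit P.det ∧
      Pᵀ * g.comp e y * P = minkowski i₀ := by
  obtain ⟨c, hc⟩ := exists_basis_coordVec he hy
  obtain ⟨b, i₀, hb⟩ := g.lorentzian (e.symm y)
  refine ⟨c.toMatrix b, i₀, ?_, ?_⟩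
  · have := c.invertibleToMatrix b
    exact (Matrix.isUnit_iff_isUnit_det _).mp (isUnit_of_invertible _)
  · have h1 := LinearMap.BilinForm.toMatrix_mul_basis_toMatrix (b := c) b (g.val (e.symm y))
    have h2 : LinearMap.BilinForm.toMatrix c (g.val (e.symm y)) = g.comp e y := by
      ext i j
      rw [LinearMap.BilinForm.toMatrix_apply, hc, hc]; rfl
    rw [h2] at h1
    rw [h1]
    ext i j
    rw [LinearMap.BilinForm.toMatrix_apply, hb]; rfl

lemma isMetricOn {e : OpenPartialHomeomorph M (EuclideanSpace ℝ (Fin n))}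
    (he : e ∈ atlas (EuclideanSpace ℝ (Fin n)) M) : Coord.IsMetricOn (g.comp e) e.target where
  isOpen := e.open_target
  smooth := fun i j => g.smooth e he i j
  symm := fun y _ i j => g.symm _ _ _
  det_ne_zero := fun y hy h0 => by
    obtain ⟨P, i₀, -, hP⟩ := g.exists_transpose_mul_comp_mul he hy
    have h1 := congrArg Matrix.det hP
    have h2 : minkowski i₀ = Matrix.diagonal fun i => if i = i₀ then (-1 : ℝ) else 1 := by
      ext i j; simp [minkowski, Matrix.diagonal_apply]
    rw [Matrix.det_mul, Matrix.det_mul, h0, mul_zero, zero_mul, h2, Matrix.det_diagonal] at h1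
    exact Finset.prod_ne_zero_iff.mpr (fun i _ => by split_ifs <;> norm_num) h1.symm

/-- The lowered components `l_i` of a smooth null vector field, as elements of the ring of smooth
functions on the domain of a chart. -/
lemma exists_lower {l : ∀ p : M, TangentSpace (𝓡 n) p} (hl : g.IsNullVectorField l)
    {e : OpenPartialHomeomorph M (EuclideanSpace ℝ (Fin n))}
    (he : e ∈ atlas (EuclideanSpace ℝ (Fin n)) M) : ∃ lo : Fin n → smoothRing e.target,
      (∀ (u : e.target) a, g.lower l e u ![a] = ev u (lo a)) ∧
      (g.isMetricOn he).formal.dot lo lo = 0 ∧ ∀ u, ∃ a, ev u (lo a) ≠ 0 := by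
  set hG := g.isMetricOn he
  have key : ∀ u : e.target, ∃ x : Fin n → ℝ, x ≠ 0 ∧ x ⬝ᵥ (g.comp e u *ᵥ x) = 0 ∧
      ∀ a, g.lower l e u ![a] = (g.comp e u *ᵥ x) a := fun u => by
    obtain ⟨c, hc⟩ := exists_basis_coordVec he u.2
    have hsum := (c.sum_repr (l (e.symm u))).symm
    have h1 : ∀ w, g.val (e.symm u) w (l (e.symm u))
        = ∑ i, c.repr (l (e.symm u)) i * g.val (e.symm u) w (c i) := fun w => by
      conv_lhs => rw [hsum]
      simp only [map_sum, map_smul, smul_eq_mul]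
    have h2 : ∀ a, g.lower l e u ![a] = (g.comp e u *ᵥ c.repr (l (e.symm u))) a := fun a => by
      have h3 : g.lower l e u ![a] = g.val (e.symm u) (l (e.symm u)) (coordVec e u a) := rfl
      rw [h3, g.symm, h1]
      simp only [Matrix.mulVec, dotProduct, hc]
      exact Finset.sum_congr rfl fun i _ => mul_comm _ _
    refine ⟨c.repr (l (e.symm u)), fun h => hl.1 (e.symm u) ?_, ?_, h2⟩
    · rw [hsum]; simp [h]
    · rw [← hl.2.1 (e.symm u), h1]
      refine Finset.sum_congr rfl fun i _ => ?_
      rw [← h2, hc]; rfl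
  refine ⟨fun a => ofFun _ (hl.2.2 e he a), fun u a => rfl, ext_ev fun u => ?_, fun u => ?_⟩
  · obtain ⟨x, -, hx, hlx⟩ := key u
    have hdet : IsUnit (g.comp e u).det := (hG.det_ne_zero u u.2).isUnit
    have h1 : (g.comp e u)⁻¹ *ᵥ (g.comp e u *ᵥ x) = x := by
      rw [Matrix.mulVec_mulVec, Matrix.nonsing_inv_mul _ hdet, Matrix.one_mulVec]
    have h2 : (g.comp e u *ᵥ x) ⬝ᵥ ((g.comp e u)⁻¹ *ᵥ (g.comp e u *ᵥ x)) = 0 := by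
      rw [h1, dotProduct_comm, hx]
    rw [map_zero, FormalMetric.dot, Coord.IsMetricOn.ev_ctr]
    refine Eq.trans ?_ h2
    simp only [map_mul, ev_ofFun, hlx]
    generalize g.comp e u *ᵥ x = z
    simp only [dotProduct, Matrix.mulVec, Finset.mul_sum]
    exact Finset.sum_congr rfl fun _ _ => Finset.sum_congr rfl fun _ _ => by ring
  · obtain ⟨x, hx0, -, hlx⟩ := key u
    by_contra! h
    have h1 : g.comp e u *ᵥ x = 0 := funext fun a => by rw [← hlx]; exact h a
    exact hG.det_ne_zero u u.2 (Matrix.exists_mulVec_eq_zero_iff.mp ⟨x, hx0, h1⟩)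

/-- In a `0`-universal Ricci-flat spacetime with a recurrent null vector the Weyl tensor has boost
order at most `-1` at every point. -/
lemma not_isGenuineTypeIIAt_of_isRicciFlat (hg : g.IsUniversal 0) (hRic : g.IsRicciFlat)
    (hrec : g.AdmitsRecurrentNullVector) (p : M) : ¬ g.IsGenuineTypeIIAt p := by
  obtain ⟨l, hl, L, hL⟩ := hrec
  have hRicF : ∀ {e} (he : e ∈ atlas (EuclideanSpace ℝ (Fin n)) M) (a b),
      (g.isMetricOn he).formal.Ric a b = 0 := fun {e} he a b => ext_ev fun u => by
    rw [← Coord.IsMetricOn.ricci_eq, map_zero]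
    exact hRic e he u u.2 a b
  have hev : ∀ {e} (he : e ∈ atlas (EuclideanSpace ℝ (Fin n)) M) (u : e.target) (a b),
      (CurvExpr.quad.subTrace (1 / 4)).eval (g.comp e) u ![a, b] =
        ev u ((g.isMetricOn he).formal.quad a b - ((1 / 4 : ℝ) •
          (g.isMetricOn he).formal.kretschmann) * (g.isMetricOn he).formal.g a b) :=
    fun {e} he u a b => (g.isMetricOn he).eval_subTrace (g.isMetricOn he).eval_quad _ u a b
  have hT := hg (CurvExpr.quad.subTrace (1 / 4)) ?_ ?_
  · rintro ⟨-, h⟩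
    refine h ?_
    have he := chart_mem_atlas (EuclideanSpace ℝ (Fin n)) p
    have hp : chartAt (EuclideanSpace ℝ (Fin n)) p p
      ∈ (chartAt (EuclideanSpace ℝ (Fin n)) p).target := mem_chart_target _ p
    obtain ⟨lo, hlo, hnull, hne⟩ := g.exists_lower hl he
    obtain ⟨L', hL'⟩ := (g.isMetricOn he).exists_recurrence lo hne
      (fun u => L ((chartAt (EuclideanSpace ℝ (Fin n)) p).symm u)) (fun u a b => by
        rw [← (g.isMetricOn he).nabla_one_eq hlo, hL _ he u u.2, hlo, hlo])
    refine (g.isMetricOn he).exists_boostOrderLE_neg_one hL' hnull hne (hRicF he) ⟨_, hp⟩ ?_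
      (g.exists_transpose_mul_comp_mul he hp)
    obtain ⟨c, hc⟩ := hT _ he _ hp
    refine ⟨c + (1 / 4) * ev ⟨_, hp⟩ (g.isMetricOn he).formal.kretschmann, fun a b => ?_⟩
    have h1 := hev he ⟨_, hp⟩ a b
    rw [hc a b, map_sub, map_mul, ev_smul, Coord.IsMetricOn.ev_g] at h1
    linear_combination -h1
  · intro e he y hy a b
    rw [hev he ⟨y, hy⟩, hev he ⟨y, hy⟩, FormalMetric.quad_symm, FormalMetric.g_symm]
  · intro e he y hy a
    rw [(g.isMetricOn he).divergence_eq (hev he) ⟨y, hy⟩,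
      FormalMetric.div2_gaussBonnet _ (hRicF he), map_zero]

/-- A `0`-universal spacetime with a covariantly constant null vector is Ricci-flat: the Einstein
tensor is proportional to the metric, and the null vector annihilates the Ricci tensor. -/
lemma isRicciFlat_of_admitsCovariantlyConstantNullVector (hg : g.IsUniversal 0)
    (hcc : g.AdmitsCovariantlyConstantNullVector) : g.IsRicciFlat := by
  obtain ⟨l, hl, hL⟩ := hcc
  have hev : ∀ {e} (he : e ∈ atlas (EuclideanSpace ℝ (Fin n)) M) (u : e.target) (a b),
      (CurvExpr.ricci.subTrace (1 / 2)).eval (g.comp e) u ![a, b] =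
        ev u ((g.isMetricOn he).formal.Ric a b - ((1 / 2 : ℝ) •
          (g.isMetricOn he).formal.scal) * (g.isMetricOn he).formal.g a b) :=
    fun {e} he u a b => (g.isMetricOn he).eval_subTrace (g.isMetricOn he).eval_ricci _ u a b
  have hT := hg (CurvExpr.ricci.subTrace (1 / 2)) ?_ ?_
  · intro e he y hy a b
    set u : e.target := ⟨y, hy⟩ with hu
    obtain ⟨lo, hlo, hnull, hne⟩ := g.exists_lower hl he
    set F := (g.isMetricOn he).formal with hF
    have hrec : ∀ a b, F.cov1 lo b a = 0 * lo a * lo b := fun a b => ext_ev fun u => by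
      rw [← (g.isMetricOn he).nabla_one_eq hlo, hL _ he u u.2, zero_mul, zero_mul, map_zero]
    have hR : ∀ b c d, F.dot lo (fun a => F.Riem a b c d) = 0 := fun b c d => by
      rw [F.dot_Riem, F.sum_mul_Rm_of_recurrent lo 0 hrec, map_zero, map_zero]; ring
    have hRic := F.dot_Ric hR
    obtain ⟨c, hc⟩ := hT e he y hy
    have hRicu : ∀ a b, ev u (F.Ric a b) = (c + 1 / 2 * ev u F.scal) * g.comp e y a b :=
      fun a b => by
        have h1 := hev he u a b
        rw [hc a b, map_sub, map_mul, ev_smul, Coord.IsMetricOn.ev_g] at h1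
        linear_combination -h1
    have hf : c + 1 / 2 * ev u F.scal = 0 := by
      obtain ⟨b, hb⟩ := hne u
      have h1 := congrArg (ev u) (F.ctr_g_right lo b)
      have h2 := congrArg (ev u) (hRic b)
      rw [(g.isMetricOn he).ev_ctr] at h1
      rw [FormalMetric.dot, (g.isMetricOn he).ev_ctr, map_zero] at h2
      refine (mul_eq_zero.mp ?_).resolve_right hb
      rw [← h1, ← h2, Finset.mul_sum]
      refine Finset.sum_congr rfl fun i _ => ?_
      rw [Finset.mul_sum]
      refine Finset.sum_congr rfl fun j _ => ?_
      rw [map_mul, map_mul, hRicu, F.g_symm, (g.isMetricOn he).ev_g]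
      ring
    rw [Coord.IsMetricOn.ricci_eq (g.isMetricOn he) u, hRicu, hf, zero_mul]
  · intro e he y hy a b
    rw [hev he ⟨y, hy⟩, hev he ⟨y, hy⟩, FormalMetric.Ric_symm, FormalMetric.g_symm]
  · intro e he y hy a
    rw [(g.isMetricOn he).divergence_eq (hev he) ⟨y, hy⟩, FormalMetric.div2_einstein, map_zero]

end LorentzMetric

theorem mainTheorem3 (n : ℕ) (M : Type*) [TopologicalSpace M]
    [ChartedSpace (EuclideanSpace ℝ (Fin n)) M] [IsManifold (𝓡 n) ∞ M]
    (g : LorentzMetric n M) (hg : g.IsUniversal 0) :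
    (g.IsRicciFlat → g.AdmitsRecurrentNullVector → ∀ p : M, ¬ g.IsGenuineTypeIIAt p) ∧
    (g.AdmitsCovariantlyConstantNullVector → ∀ p : M, ¬ g.IsGenuineTypeIIAt p) :=
  ⟨fun hRic hrec => g.not_isGenuineTypeIIAt_of_isRicciFlat hg hRic hrec, fun hcc =>
    g.not_isGenuineTypeIIAt_of_isRicciFlat hg
      (g.isRicciFlat_of_admitsCovariantlyConstantNullVector hg hcc)
      hcc.admitsRecurrentNullVector⟩
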